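/- Let $G$ be a compact group of unitary $q\times q$ complex matrices with normalized Haar measure $\eta$, let $x_1,\dots,x_N\in\mathbb{C}^q$ and $\epsilon>0$, and let $\{U^\ell\}_{\ell\in\mathcal{I}_G}$ be an enumeration of the irreducible (continuous) unitary matrix representations (IURs) of $G$, one from each equivalence class, $U^\ell$ being of dimension $d_\ell$. Let $\mathcal{H}=L^2([N]\times G)$ be the Hilbert space of tuples $f=(f_1,\dots,f_N)$, $f_i\in L^2(G)$, written $f(i,A)=f_i(A)$, with inner product $\langle f,g\rangle_{\mathcal H}=\sum_{j=1}^N\int_G f_j(A)\overline{g_j(A)}\,d\eta(A)$. Put $$W_{ij}(A,B)=e^{-\|Ax_i-Bx_j\|^2/\epsilon},\qquad D_{ii}=\sum_{j=1}^N\int_G W_{ij}(I,C)\,d\eta(C),$$ and on $\mathcal{H}$ let $\{Wf\}(i,A)=\sum_{j=1}^N\int_G W_{ij}(A,B)f_j(B)\,d\eta(B)$, $\{D^sf\}(i,A)=D_{ii}^s f_i(A)$ for $s\in\mathbb{R}$, $P=D^{-1}W$, $\tilde L=I-D^{-1}W$, and let $S$ be the integral operator with kernel $S_{ij}(A,B)=W_{ij}(A,B)/(\sqrt{D_{ii}}\sqrt{D_{jj}})$.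 For $\ell\in\mathcal{I}_G$ let $\hat W^{(\ell)}$ be the $Nd_\ell\times Nd_\ell$ matrix whose $(i,j)$ block of size $d_\ell\times d_\ell$ is $\int_G W_{ij}(I,A)\overline{U^\ell(A)}\,d\eta(A)$, let $D^{(\ell)}=\mathrm{diag}(D_{11}I_{d_\ell},\dots,D_{NN}I_{d_\ell})$ and $K^{(\ell)}=I-(D^{(\ell)})^{-1}\hat W^{(\ell)}$. For $v\in\mathbb{C}^{Nd_\ell}$ let $e^i(v)\in\mathbb{C}^{d_\ell}$ denote the $i$-th of its $N$ consecutive blocks of length $d_\ell$. Proposition 3.1. The operator $S$ equals $D^{-1/2}WD^{-1/2}$ and is symmetric. For each $\ell\in\mathcal{I}_G$ there are real eigenvalues $\tilde\lambda_{n,\ell}$ of $K^{(\ell)}$ with eigenvectors $\tilde v_{n,\ell}$, $n=1,\dots,Nd_\ell$, such that the vectors $$v_{n,\ell}=(D^{(\ell)})^{1/2}\tilde v_{n,\ell},\qquad n=1,\dots,Nd_\ell,$$ are orthonormal in $\mathbb{C}^{Nd_\ell}$. For every such choice put $\lambda_{n,\ell}=1-\tilde\lambda_{n,\ell}$ and,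 for $m=1,\dots,d_\ell$, $$\Phi_{\ell,m,n}(i,A)=\sqrt{d_\ell}\;\overline{U^\ell_{m,\cdot}(A)}\cdot e^i(v_{n,\ell}),\qquad \tilde\Phi_{\ell,m,n}(i,A)=\sqrt{d_\ell}\;\overline{U^\ell_{m,\cdot}(A)}\cdot e^i(\tilde v_{n,\ell}),$$ where $a\cdot b=\sum_k a_kb_k$. Then the functions $\Phi_{\ell,m,n}$ ($\ell\in\mathcal{I}_G$, $1\le m\le d_\ell$, $1\le n\le Nd_\ell$) are eigenfunctions of $S$, with eigenvalues $\lambda_{n,\ell}$; they are orthonormal in $\mathcal{H}$, and complete there (their linear span is dense). Each $\tilde\Phi_{\ell,m,n}$ is an eigenfunction of $P$ with eigenvalue $\lambda_{n,\ell}$ and of $\tilde L$ with eigenvalue $\tilde\lambda_{n,\ell}$, and $$\Phi_{\ell,m,n}=D^{1/2}\tilde\Phi_{\ell,m,n}.$$ -/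

import Mathlib

open MeasureTheory Matrix
open scoped ComplexConjugate

/-- A `d`-dimensional unitary matrix representation is a continuous homomorphism into `U(d)`.
It is reducible if some unitary change of basis makes all its matrices block diagonal, with two
nonempty complementary blocks of coordinates `s` and `sᶜ`. -/
def IsReducibleRep {G : Type*} [Group G] [TopologicalSpace G] {d : ℕ}
    (U : G →ₜ* Matrix.unitaryGroup (Fin d) ℂ) : Prop :=
  ∃ (Q : Matrix.unitaryGroup (Fin d) ℂ) (s : Set (Fin d)), s.Nonempty ∧ sᶜ.Nonempty ∧
    ∀ A : G, ∀ a b : Fin d, (a ∈ s ↔ b ∉ s) →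
      ((Q * U A * Q⁻¹ : Matrix.unitaryGroup (Fin d) ℂ) : Matrix (Fin d) (Fin d) ℂ) a b = 0

/-- Irreducible unitary representation (IUR). -/
def IsIrreducibleRep {G : Type*} [Group G] [TopologicalSpace G] {d : ℕ}
    (U : G →ₜ* Matrix.unitaryGroup (Fin d) ℂ) : Prop :=
  0 < d ∧ ¬ IsReducibleRep U

/-- Unitary equivalence of two unitary representations. -/
def AreEquivalentReps {G : Type*} [Group G] [TopologicalSpace G] {d e : ℕ}
    (U : G →ₜ* Matrix.unitaryGroup (Fin d) ℂ) (V : G →ₜ* Matrix.unitaryGroup (Fin e) ℂ) : Prop :=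
  ∃ T : Matrix (Fin d) (Fin e) ℂ, T * Tᴴ = 1 ∧ Tᴴ * T = 1 ∧
    ∀ A : G, (U A : Matrix (Fin d) (Fin d) ℂ) * T = T * (V A : Matrix (Fin e) (Fin e) ℂ)

/-- The family `U` enumerates the IURs of `G`: each member is an IUR, distinct members are
inequivalent, and each IUR of `G` is equivalent to some member. -/
structure EnumeratesIURs {G : Type*} [Group G] [TopologicalSpace G] {I : Type*} {d : I → ℕ}
    (U : ∀ l : I, G →ₜ* Matrix.unitaryGroup (Fin (d l)) ℂ) : Prop where
  irreducible : ∀ l, IsIrreducibleRep (U l)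
  inequivalent : ∀ l l', AreEquivalentReps (U l) (U l') → l = l'
  exhaustive : ∀ (e : ℕ) (V : G →ₜ* Matrix.unitaryGroup (Fin e) ℂ),
    IsIrreducibleRep V → ∃ l, AreEquivalentReps (U l) V

namespace GInvariantGraph

/-- The Hilbert space `L²([N] × G)`: tuples `(f_1, …, f_N)` of elements of `L²(G, η)`, with the
inner product that sums the `L²(G, η)` inner products of the components. -/
abbrev H (N : ℕ) {G : Type*} [MeasurableSpace G] (η : Measure G) : Type _ :=
  PiLp 2 (fun _ : Fin N => Lp ℂ 2 η)

noncomputable section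

section abstractGroup

variable {N : ℕ} {G : Type*} [TopologicalSpace G] [CompactSpace G]
  [MeasurableSpace G] [BorelSpace G] (η : Measure G) [IsProbabilityMeasure η]

/-- A tuple of continuous functions, as an element of `L²([N] × G)`. -/
def toH (f : Fin N → C(G, ℂ)) : H N η :=
  WithLp.toLp 2 (fun i => ContinuousMap.toLp 2 η ℂ (f i))

theorem integrable_kernel_mul (k : C(G × G, ℂ)) (f : Lp ℂ 2 η) (A : G) :
    Integrable (fun B => k (A, B) * f B) η := by
  have hf : Integrable f η := (Lp.memLp f).integrable (by norm_num)
  refine hf.bdd_mul (c := ‖k‖) ?_ (Filter.Eventually.of_forall fun B => k.norm_coe_le_norm _)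
  exact (k.continuous.comp (by fun_prop : Continuous fun B : G => (A, B))).aestronglyMeasurable

theorem continuous_integral_kernel_mul (k : C(G × G, ℂ)) (f : Lp ℂ 2 η) :
    Continuous (fun A => ∫ B, k (A, B) * f B ∂η) := by
  have hf : Integrable f η := (Lp.memLp f).integrable (by norm_num)
  rw [continuous_iff_continuousAt]
  intro A₀
  have hc : Continuous (fun A => ContinuousMap.curry k A) := (ContinuousMap.curry k).continuous
  have h1 : Filter.Tendsto (fun A => ‖ContinuousMap.curry k A - ContinuousMap.curry k A₀‖ *
      ∫ B, ‖f B‖ ∂η) (nhds A₀) (nhds 0) := by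
    have : Continuous (fun A => ‖ContinuousMap.curry k A - ContinuousMap.curry k A₀‖ *
      ∫ B, ‖f B‖ ∂η) := by fun_prop
    simpa using this.tendsto A₀
  rw [ContinuousAt, tendsto_iff_norm_sub_tendsto_zero]
  refine squeeze_zero (fun _ => norm_nonneg _) (fun A => ?_) h1
  rw [← integral_sub (integrable_kernel_mul η k f A) (integrable_kernel_mul η k f A₀),
    ← integral_const_mul]
  refine norm_integral_le_of_norm_le (hf.norm.const_mul _) (Filter.Eventually.of_forall fun B => ?_)
  rw [← sub_mul, norm_mul]
  exact mul_le_mul_of_nonneg_right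
    ((ContinuousMap.curry k A - ContinuousMap.curry k A₀).norm_coe_le_norm B) (norm_nonneg _)

/-- The function `A ↦ ∫ k(A, B) f(B) dη(B)`, which is continuous when `k` is. -/
def integralAgainst (k : C(G × G, ℂ)) (f : Lp ℂ 2 η) : C(G, ℂ) :=
  ⟨fun A => ∫ B, k (A, B) * f B ∂η, continuous_integral_kernel_mul η k f⟩

theorem integralAgainst_add (k : C(G × G, ℂ)) (f g : Lp ℂ 2 η) :
    integralAgainst η k (f + g) = integralAgainst η k f + integralAgainst η k g := by
  ext A
  change (∫ B, k (A, B) * (f + g) B ∂η : ℂ) =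
    ∫ B, k (A, B) * f B ∂η + ∫ B, k (A, B) * g B ∂η
  rw [← integral_add (integrable_kernel_mul η k f A) (integrable_kernel_mul η k g A)]
  refine integral_congr_ae ?_
  filter_upwards [Lp.coeFn_add f g] with B hB
  rw [hB, Pi.add_apply, mul_add]

theorem integralAgainst_smul (k : C(G × G, ℂ)) (c : ℂ) (f : Lp ℂ 2 η) :
    integralAgainst η k (c • f) = c • integralAgainst η k f := by
  ext A
  change (∫ B, k (A, B) * (c • f) B ∂η : ℂ) = c • ∫ B, k (A, B) * f B ∂η
  rw [← integral_smul]
  refine integral_congr_ae ?_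
  filter_upwards [Lp.coeFn_smul c f] with B hB
  rw [hB, Pi.smul_apply, smul_eq_mul, smul_eq_mul, mul_left_comm]

/-- The integral operator `(f_j)_j ↦ (i, A) ↦ ∑ⱼ ∫ k_{ij}(A, B) f_j(B) dη(B)` on
`L²([N] × G)`. -/
def kernelOp (k : Fin N → Fin N → C(G × G, ℂ)) : H N η →ₗ[ℂ] H N η where
  toFun f := toH η (fun i => ∑ j, integralAgainst η (k i j) (f j))
  map_add' f g := by
    ext1 i
    simp [toH, integralAgainst_add, Finset.sum_add_distrib]
  map_smul' c f := by
    ext1 i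
    simp [toH, integralAgainst_smul, Finset.smul_sum]

/-- The diagonal operator `{c f}(i, A) = c_i f_i(A)` on `L²([N] × G)`. -/
def diagOp (c : Fin N → ℝ) : H N η →ₗ[ℂ] H N η where
  toFun f := WithLp.toLp 2 (fun i => (c i : ℂ) • f i)
  map_add' f g := by
    ext1 i
    simp
  map_smul' c' f := by
    ext1 i
    simp [smul_comm]

end abstractGroup

/-- The functions `(i, A) ↦ √d · conj(U_{m,·}(A)) · e^i(v)`, where
`e^i(v) = (v (i, 1), …, v (i, d))` is the `i`-th block of `v ∈ ℂ^{N d}`. -/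
def eigenFun {N : ℕ} {G : Type*} [Group G] [TopologicalSpace G] {d : ℕ}
    (U : G →ₜ* Matrix.unitaryGroup (Fin d) ℂ) (m : Fin d) (v : Fin N × Fin d → ℂ) (i : Fin N) :
    C(G, ℂ) where
  toFun A := (Real.sqrt d : ℂ) *
    ∑ k : Fin d, conj ((U A : Matrix (Fin d) (Fin d) ℂ) m k) * v (i, k)
  continuous_toFun := by
    have h : Continuous fun A => (U A : Matrix (Fin d) (Fin d) ℂ) :=
      continuous_subtype_val.comp U.continuous_toFun
    have h' : ∀ k, Continuous fun A => (U A : Matrix (Fin d) (Fin d) ℂ) m k :=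
      fun k => h.matrix_elem m k
    fun_prop

section matrixGroup

variable {N q : ℕ} {G : Subgroup (Matrix.unitaryGroup (Fin q) ℂ)}

/-- The action of a matrix `A ∈ G` on a point of `ℂ^q`. -/
def act (A : G) (y : EuclideanSpace ℂ (Fin q)) : EuclideanSpace ℂ (Fin q) :=
  Matrix.toEuclideanLin ((A : Matrix.unitaryGroup (Fin q) ℂ) : Matrix (Fin q) (Fin q) ℂ) y

theorem continuous_act (y : EuclideanSpace ℂ (Fin q)) : Continuous fun A : G => act A y := by
  have h : Continuous fun A : G =>
      ((A : Matrix.unitaryGroup (Fin q) ℂ) : Matrix (Fin q) (Fin q) ℂ) :=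
    continuous_subtype_val.comp continuous_subtype_val
  unfold act
  simp only [Matrix.toEuclideanLin, Matrix.toLpLin_apply]
  exact (PiLp.continuous_toLp 2 _).comp (h.matrix_mulVec continuous_const)

/-- The affinities `W_{ij}(A, B) = exp(-‖A x_i - B x_j‖² / ε)`. -/
def W (ε : ℝ) (x : Fin N → EuclideanSpace ℂ (Fin q)) (i j : Fin N) : C(G × G, ℝ) where
  toFun p := Real.exp (-‖act p.1 (x i) - act p.2 (x j)‖ ^ 2 / ε)
  continuous_toFun := by
    have h1 := (continuous_act (G := G) (x i)).comp (continuous_fst (X := G) (Y := G))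
    have h2 := (continuous_act (G := G) (x j)).comp (continuous_snd (X := G) (Y := G))
    have h3 := (h1.sub h2).norm.pow 2
    exact Real.continuous_exp.comp (h3.neg.div_const ε)

variable [MeasurableSpace G] (η : Measure G) (ε : ℝ) (x : Fin N → EuclideanSpace ℂ (Fin q))

/-- `D_{ii} = ∑ⱼ ∫ W_{ij}(I, C) dη(C)`. -/
def D (i : Fin N) : ℝ := ∑ j, ∫ C : G, W ε x i j (1, C) ∂η

/-- The kernel of `S`: `S_{ij}(A, B) = W_{ij}(A, B) / (√D_{ii} √D_{jj})`. -/
def SKernel (i j : Fin N) : C(G × G, ℂ) where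
  toFun p := ((W ε x i j p / (Real.sqrt (D η ε x i) * Real.sqrt (D η ε x j)) : ℝ) : ℂ)
  continuous_toFun :=
    Complex.continuous_ofReal.comp ((W ε x i j).continuous.div_const _)

/-- The kernel of `W`, with complex values. -/
def WKernel (i j : Fin N) : C(G × G, ℂ) where
  toFun p := ((W ε x i j p : ℝ) : ℂ)
  continuous_toFun := Complex.continuous_ofReal.comp (W ε x i j).continuous

section operators

variable [BorelSpace G] [CompactSpace G] [IsProbabilityMeasure η]

/-- The operator `W` on `L²([N] × G)`. -/
def opW : H N η →ₗ[ℂ] H N η := kernelOp η (WKernel ε x)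

/-- The symmetric operator `S`. -/
def opS : H N η →ₗ[ℂ] H N η := kernelOp η (SKernel η ε x)

/-- The transition operator `P = D⁻¹ W`. -/
def opP : H N η →ₗ[ℂ] H N η := diagOp η (fun i => (D η ε x i)⁻¹) ∘ₗ opW η ε x

/-- The normalized `G`-invariant graph Laplacian `I - D⁻¹ W`. -/
def opL : H N η →ₗ[ℂ] H N η :=
  LinearMap.id - diagOp η (fun i => (D η ε x i)⁻¹) ∘ₗ opW η ε x

end operators

variable {d : ℕ} (U : G →ₜ* Matrix.unitaryGroup (Fin d) ℂ)

/-- The `Nd × Nd` block matrix of Fourier coefficients, whose `(i, j)` block is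
`∫ W_{ij}(I, A) conj(U(A)) dη(A)`. -/
def WHat : Matrix (Fin N × Fin d) (Fin N × Fin d) ℂ :=
  fun p r => ∫ A : G, (W ε x p.1 r.1 (1, A) : ℂ) *
    conj ((U A : Matrix (Fin d) (Fin d) ℂ) p.2 r.2) ∂η

/-- The block-diagonal matrix `diag(D_{11} I_d, …, D_{NN} I_d)`. -/
def DBlock (d : ℕ) : Matrix (Fin N × Fin d) (Fin N × Fin d) ℂ :=
  Matrix.diagonal fun p => (D η ε x p.1 : ℂ)

/-- The square root of the block-diagonal matrix `DBlock`. -/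
def DBlockSqrt (d : ℕ) : Matrix (Fin N × Fin d) (Fin N × Fin d) ℂ :=
  Matrix.diagonal fun p => (Real.sqrt (D η ε x p.1) : ℂ)

/-- `K = I - D⁻¹ Ŵ`. -/
def K : Matrix (Fin N × Fin d) (Fin N × Fin d) ℂ :=
  1 - (DBlock η ε x d)⁻¹ * WHat η ε x U

/-- `(lamT n, vT n)`, for `n = 1, …, Nd`, is a full system of eigenpairs of `K`, with the
eigenvectors normalized so that the vectors `D^{1/2} vT n` are orthonormal in `ℂ^{Nd}`. -/
structure IsEigenSystem (lamT : Fin (N * d) → ℝ) (vT : Fin (N * d) → Fin N × Fin d → ℂ) :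
    Prop where
  eigen : ∀ n, Module.End.HasEigenvector (Matrix.toLin' (K η ε x U)) (lamT n : ℂ) (vT n)
  orthonormal : Orthonormal ℂ fun n =>
    (WithLp.toLp 2 (DBlockSqrt η ε x d *ᵥ vT n) : EuclideanSpace ℂ (Fin N × Fin d))

end matrixGroup

end

end GInvariantGraph

/-! Unitary matrices preserve distances, so the kernel `W` is invariant under simultaneous left
translation of its two group arguments. Substituting `B ↦ A * B` turns the integral of `W_ij(A, B)`
against `conj (U B)` into `conj (U A)` times a Fourier coefficient. Hence, for each representation
`U` and row `m`, the linear map `v ↦ eigenFun U m v` intertwines the integral operator with the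
finite matrix `WHat` (`opW_eigenFun`). It also commutes with the diagonal scalings, so the
eigenvalue equations for `S`, `P` and the Laplacian reduce to those of `D⁻¹ Ŵ`. That matrix is
similar to `D^{-1/2} Ŵ D^{-1/2}`, which is Hermitian by inversion invariance of `η`
(`WHat_isHermitian`), and the spectral theorem provides the eigensystem.

Orthonormality comes from Schur orthogonality: for irreducible `U` the factor `√d` makes `v ↦
eigenFun U m v` isometric, and different `(l, m)` have orthogonal images (`inner_eigenFun_self`,
`inner_eigenFun_eq_zero`).

Completeness is Peter–Weyl for a matrix group. Tensor products, conjugates and complete reducibility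
make the span of the irreducible matrix coefficients a unital star-subalgebra of `C(G, ℂ)`. It
separates points because `G` is itself represented faithfully by matrices, so Stone–Weierstrass
applies, and continuous functions are dense in `L²`. -/

section representations

/-! ### Schur's lemma for unitary matrix representations. -/

variable {G : Type*} [Group G] [TopologicalSpace G]

theorem rep_conjTranspose {d : ℕ} (U : G →ₜ* Matrix.unitaryGroup (Fin d) ℂ) (A : G) :
    ((U A : Matrix (Fin d) (Fin d) ℂ))ᴴ = (U A⁻¹ : Matrix (Fin d) (Fin d) ℂ) := by
  rw [map_inv]; rfl

theorem rep_mul {d : ℕ} (U : G →ₜ* Matrix.unitaryGroup (Fin d) ℂ) (A B : G) :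
    (U (A * B) : Matrix (Fin d) (Fin d) ℂ) = (U A : Matrix (Fin d) (Fin d) ℂ) * U B := by
  rw [map_mul]; rfl

theorem rep_conjTranspose_mul {d : ℕ} (U : G →ₜ* Matrix.unitaryGroup (Fin d) ℂ) (A : G) :
    (U A : Matrix (Fin d) (Fin d) ℂ)ᴴ * (U A : Matrix (Fin d) (Fin d) ℂ) = 1 :=
  Matrix.mem_unitaryGroup_iff'.mp (U A).2

theorem continuous_rep_apply {d : ℕ} (U : G →ₜ* Matrix.unitaryGroup (Fin d) ℂ) (m k : Fin d) :
    Continuous fun A => (U A : Matrix (Fin d) (Fin d) ℂ) m k := by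
  have h : Continuous fun A => (U A : Matrix (Fin d) (Fin d) ℂ) :=
    continuous_subtype_val.comp U.continuous_toFun
  exact h.matrix_elem m k

/-- The adjoint of an intertwiner intertwines in the opposite direction. -/
theorem conjTranspose_intertwines {d e : ℕ} {U : G →ₜ* Matrix.unitaryGroup (Fin d) ℂ}
    {V : G →ₜ* Matrix.unitaryGroup (Fin e) ℂ} {T : Matrix (Fin d) (Fin e) ℂ}
    (hT : ∀ A : G, (U A : Matrix (Fin d) (Fin d) ℂ) * T = T * (V A : Matrix (Fin e) (Fin e) ℂ))
    (A : G) :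
    (V A : Matrix (Fin e) (Fin e) ℂ) * Tᴴ = Tᴴ * (U A : Matrix (Fin d) (Fin d) ℂ) := by
  have h := congrArg conjTranspose (hT A⁻¹)
  rw [conjTranspose_mul, conjTranspose_mul, rep_conjTranspose, rep_conjTranspose, inv_inv] at h
  exact h.symm

/-- Schur's lemma for Hermitian matrices. -/
theorem IsIrreducibleRep.exists_eq_smul_one_of_isHermitian {d : ℕ}
    {U : G →ₜ* Matrix.unitaryGroup (Fin d) ℂ} (hU : IsIrreducibleRep U)
    {T : Matrix (Fin d) (Fin d) ℂ} (hT : T.IsHermitian)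
    (hc : ∀ A : G, (U A : Matrix (Fin d) (Fin d) ℂ) * T = T * (U A : Matrix (Fin d) (Fin d) ℂ)) :
    ∃ c : ℂ, T = c • (1 : Matrix (Fin d) (Fin d) ℂ) := by
  obtain ⟨hd, hirr⟩ := hU
  let a₀ : Fin d := ⟨0, hd⟩
  set Q := hT.eigenvectorUnitary with hQ
  set D : Matrix (Fin d) (Fin d) ℂ := diagonal (fun a => (hT.eigenvalues a : ℂ)) with hD
  have hQ1 : (Q : Matrix (Fin d) (Fin d) ℂ) * (Q : Matrix (Fin d) (Fin d) ℂ)ᴴ = 1 :=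
    Matrix.mem_unitaryGroup_iff.mp Q.2
  have hQ2 : (Q : Matrix (Fin d) (Fin d) ℂ)ᴴ * (Q : Matrix (Fin d) (Fin d) ℂ) = 1 :=
    Matrix.mem_unitaryGroup_iff'.mp Q.2
  have hspec : T = (Q : Matrix (Fin d) (Fin d) ℂ) * D * (Q : Matrix (Fin d) (Fin d) ℂ)ᴴ := by
    have := hT.spectral_theorem
    rwa [Unitary.conjStarAlgAut_apply] at this
  by_cases hall : ∀ a, hT.eigenvalues a = hT.eigenvalues a₀
  · refine ⟨(hT.eigenvalues a₀ : ℂ), ?_⟩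
    have hDs : D = (hT.eigenvalues a₀ : ℂ) • (1 : Matrix (Fin d) (Fin d) ℂ) := by
      simp only [hD, hall, smul_one_eq_diagonal]
    refine hspec.trans ?_
    rw [hDs]
    simp [hQ1]
  · exfalso
    push Not at hall
    -- Two distinct eigenvalues would reduce `U`: in an eigenbasis of `T` the eigenspace of the
    -- first eigenvalue is split off. The change of basis is `Q⁻¹` because `T = Q D Q*`.
    refine hirr ⟨Q⁻¹, {a | hT.eigenvalues a = hT.eigenvalues a₀}, ⟨a₀, rfl⟩, hall, ?_⟩
    intro A a b hab
    set M : Matrix (Fin d) (Fin d) ℂ :=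
      (Q : Matrix (Fin d) (Fin d) ℂ)ᴴ * (U A : Matrix (Fin d) (Fin d) ℂ) * Q with hM
    have hMD : M * D = D * M := by
      have h1 : D = (Q : Matrix (Fin d) (Fin d) ℂ)ᴴ * T * Q := by
        rw [hspec]
        simp only [Matrix.mul_assoc, hQ2, Matrix.mul_one]
        rw [← Matrix.mul_assoc, hQ2, Matrix.one_mul]
      rw [h1, hM]
      calc _ = (Q : Matrix (Fin d) (Fin d) ℂ)ᴴ * U A * (Q * (Q : Matrix (Fin d) (Fin d) ℂ)ᴴ) * T * Q := by
            simp only [Matrix.mul_assoc]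
        _ = (Q : Matrix (Fin d) (Fin d) ℂ)ᴴ * (U A * T) * Q := by
            rw [hQ1]; simp only [Matrix.mul_assoc, Matrix.one_mul]
        _ = (Q : Matrix (Fin d) (Fin d) ℂ)ᴴ * T * (Q * (Q : Matrix (Fin d) (Fin d) ℂ)ᴴ) * U A * Q := by
            rw [hc, hQ1]; simp only [Matrix.mul_assoc, Matrix.one_mul]
        _ = _ := by simp only [Matrix.mul_assoc]
    -- Commuting with `D` says that `M a b` times the difference of the eigenvalues at `a` and `b`
    -- is zero.
    have hentry := congrFun (congrFun hMD a) b
    rw [hD, Matrix.mul_diagonal, Matrix.diagonal_mul] at hentry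
    have hne : hT.eigenvalues a ≠ hT.eigenvalues b := by
      intro h
      simp only [Set.mem_ofPred_eq, h] at hab
      tauto
    have hM0 : M a b = 0 := by
      by_contra h0
      apply hne
      have : (hT.eigenvalues b : ℂ) = hT.eigenvalues a := by
        rw [mul_comm] at hentry
        exact mul_right_cancel₀ h0 hentry
      exact_mod_cast this.symm
    simpa [hM, star_eq_conjTranspose] using hM0

/-- Schur's lemma for a single irreducible representation. -/
theorem IsIrreducibleRep.exists_eq_smul_one {d : ℕ}
    {U : G →ₜ* Matrix.unitaryGroup (Fin d) ℂ} (hU : IsIrreducibleRep U)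
    {T : Matrix (Fin d) (Fin d) ℂ}
    (hc : ∀ A : G, (U A : Matrix (Fin d) (Fin d) ℂ) * T = T * (U A : Matrix (Fin d) (Fin d) ℂ)) :
    ∃ c : ℂ, T = c • (1 : Matrix (Fin d) (Fin d) ℂ) := by
  have hc' := conjTranspose_intertwines hc
  -- Split `T` into Hermitian and skew-Hermitian parts; the factor `I` makes the second one
  -- Hermitian.
  obtain ⟨a, ha⟩ := hU.exists_eq_smul_one_of_isHermitian (T := T + Tᴴ)
    (by simp [IsHermitian, add_comm]) (fun A => by rw [mul_add, add_mul, hc, hc'])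
  obtain ⟨b, hb⟩ := hU.exists_eq_smul_one_of_isHermitian (T := Complex.I • (T - Tᴴ))
    (by simp [IsHermitian, ← smul_neg])
    (fun A => by rw [Matrix.mul_smul, Matrix.smul_mul, mul_sub, sub_mul, hc, hc'])
  refine ⟨(a - Complex.I * b) / 2, ?_⟩
  have hb' : T - Tᴴ = (-Complex.I * b) • (1 : Matrix (Fin d) (Fin d) ℂ) := by
    rw [mul_smul, ← hb, smul_smul]; simp
  have h2 : (2 : ℂ) • T = (a - Complex.I * b) • (1 : Matrix (Fin d) (Fin d) ℂ) := by
    calc (2 : ℂ) • T = (T + Tᴴ) + (T - Tᴴ) := by rw [two_smul]; abel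
      _ = _ := by rw [ha, hb', ← add_smul]; congr 1; ring
  rw [div_eq_inv_mul, mul_smul, ← h2, smul_smul]
  simp

open scoped ComplexOrder in
/-- Schur's lemma for two inequivalent irreducible representations. -/
theorem IsIrreducibleRep.intertwiner_eq_zero {d e : ℕ}
    {U : G →ₜ* Matrix.unitaryGroup (Fin d) ℂ} {V : G →ₜ* Matrix.unitaryGroup (Fin e) ℂ}
    (hU : IsIrreducibleRep U) (hV : IsIrreducibleRep V) (hUV : ¬ AreEquivalentReps U V)
    {T : Matrix (Fin d) (Fin e) ℂ}
    (hT : ∀ A : G, (U A : Matrix (Fin d) (Fin d) ℂ) * T = T * (V A : Matrix (Fin e) (Fin e) ℂ)) :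
    T = 0 := by
  have hT' := conjTranspose_intertwines hT
  obtain ⟨c, hc⟩ := hU.exists_eq_smul_one (T := T * Tᴴ) (fun A => by
    rw [← Matrix.mul_assoc, hT, Matrix.mul_assoc, hT', Matrix.mul_assoc])
  obtain ⟨c', hc'⟩ := hV.exists_eq_smul_one (T := Tᴴ * T) (fun A => by
    rw [← Matrix.mul_assoc, hT', Matrix.mul_assoc, hT, Matrix.mul_assoc])
  by_contra hne
  -- Evaluate `T Tᴴ T` in both groupings.
  have hcc : c' = c := by
    have h : c • T = c' • T := by
      calc c • T = T * Tᴴ * T := by rw [hc]; simp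
        _ = c' • T := by rw [Matrix.mul_assoc, hc']; simp
    have h' : (c' - c) • T = 0 := by rw [sub_smul, h, sub_self]
    exact sub_eq_zero.mp ((smul_eq_zero.mp h').resolve_right hne)
  subst hcc
  let a₀ : Fin d := ⟨0, hU.1⟩
  have hcnn : 0 ≤ c' := by
    have h := (Matrix.posSemidef_self_mul_conjTranspose T).diag_nonneg (i := a₀)
    simpa [hc] using h
  have hc0 : c' ≠ 0 := by
    rintro rfl
    exact hne (Matrix.self_mul_conjTranspose_eq_zero.mp (by simpa using hc))
  obtain ⟨r, hr, rfl⟩ := (RCLike.nonneg_iff_exists_ofReal (K := ℂ)).mp hcnn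
  have hr0 : r ≠ 0 := by rintro rfl; simp at hc0
  have hs : ((Real.sqrt r)⁻¹ : ℂ) * ((Real.sqrt r)⁻¹ : ℂ) * (r : ℂ) = 1 := by
    rw [← mul_inv, ← Complex.ofReal_mul, Real.mul_self_sqrt hr]
    exact inv_mul_cancel₀ (by exact_mod_cast hr0)
  -- A nonzero intertwiner satisfies `T Tᴴ = r` and `Tᴴ T = r` with `r > 0`, so rescaling it gives a
  -- unitary equivalence.
  refine hUV ⟨((Real.sqrt r)⁻¹ : ℂ) • T, ?_, ?_, fun A => ?_⟩
  · rw [conjTranspose_smul, Matrix.smul_mul, Matrix.mul_smul, hc, smul_smul, smul_smul]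
    simpa [mul_assoc] using congrArg (· • (1 : Matrix (Fin d) (Fin d) ℂ)) hs
  · rw [conjTranspose_smul, Matrix.smul_mul, Matrix.mul_smul, hc', smul_smul, smul_smul]
    simpa [mul_assoc] using congrArg (· • (1 : Matrix (Fin e) (Fin e) ℂ)) hs
  · rw [Matrix.mul_smul, Matrix.smul_mul, hT]

end representations

/-! ### Schur orthogonality of matrix coefficients. -/

section orthogonality

variable {G : Type*} [Group G] [TopologicalSpace G] [IsTopologicalGroup G] [CompactSpace G]
  [MeasurableSpace G] [BorelSpace G] (η : Measure G) [IsProbabilityMeasure η]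

omit [Group G] [IsTopologicalGroup G] in
theorem integrable_of_continuous {f : G → ℂ} (hf : Continuous f) : Integrable f η :=
  hf.integrable_of_hasCompactSupport (HasCompactSupport.of_compactSpace f)

variable [η.IsMulLeftInvariant]

/-- The matrix of the inner products of the entries in two given columns of two representations
is an intertwiner. -/
theorem integral_rep_mul_conj_intertwines {d e : ℕ} (U : G →ₜ* Matrix.unitaryGroup (Fin d) ℂ)
    (V : G →ₜ* Matrix.unitaryGroup (Fin e) ℂ) (k : Fin d) (k' : Fin e) (B : G) :
    (U B : Matrix (Fin d) (Fin d) ℂ) * Matrix.of (fun m m' =>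
        ∫ A, (U A : Matrix (Fin d) (Fin d) ℂ) m k * conj ((V A : Matrix (Fin e) (Fin e) ℂ) m' k') ∂η) =
      Matrix.of (fun m m' =>
        ∫ A, (U A : Matrix (Fin d) (Fin d) ℂ) m k * conj ((V A : Matrix (Fin e) (Fin e) ℂ) m' k') ∂η) *
      (V B : Matrix (Fin e) (Fin e) ℂ) := by
  set T : Matrix (Fin d) (Fin e) ℂ := Matrix.of (fun m m' =>
    ∫ A, (U A : Matrix (Fin d) (Fin d) ℂ) m k * conj ((V A : Matrix (Fin e) (Fin e) ℂ) m' k') ∂η)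
    with hT
  have hcU := continuous_rep_apply U
  have hcV := continuous_rep_apply V
  -- Left invariance: replacing `A` by `B * A` in the integral conjugates `T` by `U B` and `V B`.
  have key : (U B : Matrix (Fin d) (Fin d) ℂ) * T * (V B : Matrix (Fin e) (Fin e) ℂ)ᴴ = T := by
    ext n n'
    have h1 : T n n' = ∫ A, (U (B * A) : Matrix (Fin d) (Fin d) ℂ) n k *
        conj ((V (B * A) : Matrix (Fin e) (Fin e) ℂ) n' k') ∂η :=
      (integral_mul_left_eq_self (fun A => (U A : Matrix (Fin d) (Fin d) ℂ) n k *
        conj ((V A : Matrix (Fin e) (Fin e) ℂ) n' k')) B).symm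
    have h2 : ∀ A, (U (B * A) : Matrix (Fin d) (Fin d) ℂ) n k *
        conj ((V (B * A) : Matrix (Fin e) (Fin e) ℂ) n' k') =
        ∑ m', ∑ m, ((U B : Matrix (Fin d) (Fin d) ℂ) n m *
          ((U A : Matrix (Fin d) (Fin d) ℂ) m k * conj ((V A : Matrix (Fin e) (Fin e) ℂ) m' k'))) *
          conj ((V B : Matrix (Fin e) (Fin e) ℂ) n' m') := by
      intro A
      rw [rep_mul, rep_mul, Matrix.mul_apply, Matrix.mul_apply, map_sum, Finset.sum_mul_sum,
        Finset.sum_comm]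
      refine Finset.sum_congr rfl fun _ _ => Finset.sum_congr rfl fun _ _ => ?_
      rw [map_mul]; ring
    have hint : ∀ m m', Integrable (fun A => ((U B : Matrix (Fin d) (Fin d) ℂ) n m *
          ((U A : Matrix (Fin d) (Fin d) ℂ) m k * conj ((V A : Matrix (Fin e) (Fin e) ℂ) m' k'))) *
          conj ((V B : Matrix (Fin e) (Fin e) ℂ) n' m')) η := by
      intro m m'
      apply integrable_of_continuous
      have := hcU m k
      have := hcV m' k'
      fun_prop
    rw [h1, Matrix.mul_apply]
    simp_rw [h2]
    rw [integral_finsetSum _ fun m' _ => integrable_finsetSum _ fun m _ => hint m m']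
    refine Finset.sum_congr rfl fun m' _ => ?_
    rw [integral_finsetSum _ fun m _ => hint m m', Matrix.mul_apply, Finset.sum_mul]
    refine Finset.sum_congr rfl fun m _ => ?_
    rw [integral_mul_const, integral_const_mul]
    rfl
  calc _ = (U B : Matrix (Fin d) (Fin d) ℂ) * T * ((V B : Matrix (Fin e) (Fin e) ℂ)ᴴ *
        (V B : Matrix (Fin e) (Fin e) ℂ)) := by
        rw [rep_conjTranspose_mul, Matrix.mul_one]
    _ = _ := by rw [← Matrix.mul_assoc, key]

/-- Orthogonality of the matrix entries of inequivalent irreducible representations. -/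
theorem integral_rep_mul_conj_eq_zero {d e : ℕ} {U : G →ₜ* Matrix.unitaryGroup (Fin d) ℂ}
    {V : G →ₜ* Matrix.unitaryGroup (Fin e) ℂ} (hU : IsIrreducibleRep U) (hV : IsIrreducibleRep V)
    (hUV : ¬ AreEquivalentReps U V) (m k : Fin d) (m' k' : Fin e) :
    ∫ A, (U A : Matrix (Fin d) (Fin d) ℂ) m k *
      conj ((V A : Matrix (Fin e) (Fin e) ℂ) m' k') ∂η = 0 :=
  congrFun (congrFun (hU.intertwiner_eq_zero hV hUV
    (integral_rep_mul_conj_intertwines η U V k k')) m) m'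

/-- Orthogonality of the matrix entries of an irreducible representation. -/
theorem integral_rep_mul_conj_self {d : ℕ} {U : G →ₜ* Matrix.unitaryGroup (Fin d) ℂ}
    (hU : IsIrreducibleRep U) (m k m' k' : Fin d) :
    ∫ A, (U A : Matrix (Fin d) (Fin d) ℂ) m k *
      conj ((U A : Matrix (Fin d) (Fin d) ℂ) m' k') ∂η =
      if m = m' ∧ k = k' then (d : ℂ)⁻¹ else 0 := by
  obtain ⟨c, hc⟩ := hU.exists_eq_smul_one (integral_rep_mul_conj_intertwines η U U k k')
  have hent : ∀ n n', ∫ A, (U A : Matrix (Fin d) (Fin d) ℂ) n k *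
      conj ((U A : Matrix (Fin d) (Fin d) ℂ) n' k') ∂η = if n = n' then c else 0 := by
    intro n n'
    have := congrFun (congrFun hc n) n'
    simpa [Matrix.one_apply] using this
  have hd : (d : ℂ) ≠ 0 := by exact_mod_cast hU.1.ne'
  -- The scalar is found from the trace: under the integral it becomes the inner product of columns
  -- `k` and `k'` of a unitary matrix.
  have htr : (d : ℂ) * c = if k = k' then 1 else 0 := by
    calc (d : ℂ) * c = ∑ n : Fin d, ∫ A, (U A : Matrix (Fin d) (Fin d) ℂ) n k *
          conj ((U A : Matrix (Fin d) (Fin d) ℂ) n k') ∂η := by simp [hent]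
      _ = ∫ A, ∑ n : Fin d, (U A : Matrix (Fin d) (Fin d) ℂ) n k *
          conj ((U A : Matrix (Fin d) (Fin d) ℂ) n k') ∂η := by
          rw [integral_finsetSum]
          intro n _
          apply integrable_of_continuous
          have := continuous_rep_apply U n
          fun_prop
      _ = ∫ A : G, (if k = k' then 1 else 0 : ℂ) ∂η := by
          congr 1
          ext A
          have := congrFun (congrFun (rep_conjTranspose_mul U A) k') k
          rw [Matrix.mul_apply, Matrix.one_apply] at this
          simp only [conjTranspose_apply] at this
          simp only [eq_comm (a := k), ← this]
          exact Finset.sum_congr rfl fun n _ => mul_comm _ _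
      _ = _ := by simp
  have hcval : c = if k = k' then (d : ℂ)⁻¹ else 0 := by
    apply mul_left_cancel₀ hd
    rw [htr]
    split_ifs <;> simp [hd]
  rw [hent, hcval]
  by_cases h1 : m = m' <;> by_cases h2 : k = k' <;> simp [h1, h2]

end orthogonality

/-! ### The algebra of matrix coefficients and its density in `C(G, ℂ)`. -/

section coefficients

variable {G : Type*} [Group G] [TopologicalSpace G]

/-- A continuous multiplicative family of unitary matrices over any finite index type gives a
representation. -/
theorem exists_rep_of_family {ι : Type*} [Fintype ι] [DecidableEq ι] (M : G → Matrix ι ι ℂ)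
    (hc : Continuous M) (hm : ∀ A B, M (A * B) = M A * M B)
    (hu : ∀ A, M A ∈ Matrix.unitaryGroup ι ℂ) :
    ∃ V : G →ₜ* Matrix.unitaryGroup (Fin (Fintype.card ι)) ℂ, ∀ A a b,
      (V A : Matrix (Fin (Fintype.card ι)) (Fin (Fintype.card ι)) ℂ)
        (Fintype.equivFin ι a) (Fintype.equivFin ι b) = M A a b := by
  let e := Fintype.equivFin ι
  have hmem : ∀ A, (M A).submatrix e.symm e.symm ∈ Matrix.unitaryGroup _ ℂ := by
    intro A
    rw [Matrix.mem_unitaryGroup_iff, star_eq_conjTranspose, conjTranspose_submatrix,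
      submatrix_mul_equiv, ← star_eq_conjTranspose, Matrix.mem_unitaryGroup_iff.mp (hu A),
      submatrix_one_equiv]
  refine ⟨⟨MonoidHom.mk' (fun A => ⟨(M A).submatrix e.symm e.symm, hmem A⟩) fun A B => ?_, ?_⟩,
    fun A a b => ?_⟩
  · apply Subtype.ext
    change (M (A * B)).submatrix e.symm e.symm =
      (M A).submatrix e.symm e.symm * (M B).submatrix e.symm e.symm
    rw [submatrix_mul_equiv, hm]
  · exact (hc.matrix_submatrix e.symm e.symm).subtype_mk hmem
  · change (M A).submatrix e.symm e.symm (e a) (e b) = M A a b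
    simp

/-- A matrix coefficient of a representation, as a continuous function. -/
noncomputable def matrixCoeff {d : ℕ} (U : G →ₜ* Matrix.unitaryGroup (Fin d) ℂ) (m k : Fin d) : C(G, ℂ) :=
  ⟨fun A => (U A : Matrix (Fin d) (Fin d) ℂ) m k, continuous_rep_apply U m k⟩

/-- A set of coordinates that is invariant in some orthonormal basis gives a subrepresentation. -/
theorem exists_block_rep {d : ℕ} (V : G →ₜ* Matrix.unitaryGroup (Fin d) ℂ)
    (Q : Matrix.unitaryGroup (Fin d) ℂ) (s : Set (Fin d)) [Fintype s]
    (h : ∀ A : G, ∀ a b : Fin d, a ∈ s → b ∉ s →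
      ((Q * V A * Q⁻¹ : Matrix.unitaryGroup (Fin d) ℂ) : Matrix (Fin d) (Fin d) ℂ) a b = 0) :
    ∃ W : G →ₜ* Matrix.unitaryGroup (Fin (Fintype.card s)) ℂ, ∀ A (a b : s),
      (W A : Matrix (Fin (Fintype.card s)) (Fin (Fintype.card s)) ℂ)
        (Fintype.equivFin s a) (Fintype.equivFin s b) =
      ((Q * V A * Q⁻¹ : Matrix.unitaryGroup (Fin d) ℂ) : Matrix (Fin d) (Fin d) ℂ) a b := by
  classical
  let R : G → Matrix (Fin d) (Fin d) ℂ := fun A => (Q * V A * Q⁻¹ : Matrix.unitaryGroup (Fin d) ℂ)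
  have hR0 : ∀ A, (R A).toBlock (· ∈ s) (fun a => ¬ a ∈ s) = 0 := by
    intro A
    ext a b
    exact h A a b a.2 b.2
  have hRm : ∀ A B, R (A * B) = R A * R B := by
    intro A B
    change ((Q * V (A * B) * Q⁻¹ : Matrix.unitaryGroup (Fin d) ℂ) : Matrix (Fin d) (Fin d) ℂ) =
      ((Q * V A * Q⁻¹) * (Q * V B * Q⁻¹) : Matrix.unitaryGroup (Fin d) ℂ)
    rw [map_mul]
    congr 1
    group
  -- The vanishing block kills the cross term whatever the second factor is. `B = R A'` will give
  -- multiplicativity and `B = (R A)ᴴ` unitarity of the compression.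
  have hmul : ∀ A (B : Matrix (Fin d) (Fin d) ℂ), (R A * B).toBlock (· ∈ s) (· ∈ s) =
      (R A).toBlock (· ∈ s) (· ∈ s) * B.toBlock (· ∈ s) (· ∈ s) := by
    intro A B
    rw [toBlock_mul_eq_add (· ∈ s) (· ∈ s) (· ∈ s), hR0, Matrix.zero_mul, add_zero]
    congr!
  refine exists_rep_of_family (fun A => (R A).toBlock (· ∈ s) (· ∈ s)) ?_ ?_ ?_
  · have hR : Continuous R := by
      refine continuous_subtype_val.comp ?_
      have := V.continuous_toFun
      exact (continuous_const.mul this).mul continuous_const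
    exact hR.matrix_submatrix _ _
  · intro A B
    rw [hRm, hmul]
  · intro A
    have hu : R A * (R A)ᴴ = 1 := Matrix.mem_unitaryGroup_iff.mp (Q * V A * Q⁻¹).2
    have hb := hmul A (R A)ᴴ
    rw [hu, toBlock_one_self] at hb
    exact Matrix.mem_unitaryGroup_iff.mpr hb.symm

variable {I : Type*} {d : I → ℕ}

/-- The span of the matrix coefficients of a family of representations. -/
noncomputable def coeffSpan (U : ∀ l : I, G →ₜ* Matrix.unitaryGroup (Fin (d l)) ℂ) : Submodule ℂ C(G, ℂ) :=
  Submodule.span ℂ (Set.range fun p : (l : I) × (Fin (d l) × Fin (d l)) =>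
    matrixCoeff (U p.1) p.2.1 p.2.2)

theorem matrixCoeff_mem_coeffSpan_self (U : ∀ l : I, G →ₜ* Matrix.unitaryGroup (Fin (d l)) ℂ)
    (l : I) (m k : Fin (d l)) : matrixCoeff (U l) m k ∈ coeffSpan U :=
  Submodule.subset_span ⟨⟨l, m, k⟩, rfl⟩

variable {U : ∀ l : I, G →ₜ* Matrix.unitaryGroup (Fin (d l)) ℂ}

/-- Complete reducibility: the matrix coefficients of every representation are linear combinations
of those of the irreducible ones. -/
theorem matrixCoeff_mem_coeffSpan (hU : EnumeratesIURs U) :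
    ∀ {e : ℕ} (V : G →ₜ* Matrix.unitaryGroup (Fin e) ℂ) (a b : Fin e),
      matrixCoeff V a b ∈ coeffSpan U := by
  intro e
  induction e using Nat.strong_induction_on with
  | _ e ih =>
  intro V a b
  by_cases hirr : IsReducibleRep V
  · classical
    obtain ⟨Q, s, hs, hs', h⟩ := hirr
    -- Stated for a general `t` to serve both `s` and `sᶜ`; a nonempty complement makes the block
    -- smaller, so the induction hypothesis covers it.
    have hmem : ∀ (t : Set (Fin e)), tᶜ.Nonempty →
        (∀ A : G, ∀ a b : Fin e, a ∈ t → b ∉ t →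
          ((Q * V A * Q⁻¹ : Matrix.unitaryGroup (Fin e) ℂ) : Matrix (Fin e) (Fin e) ℂ) a b = 0) →
        ∀ a ∈ t, ∀ b ∈ t, ∃ f ∈ coeffSpan U, ∀ A, f A =
          ((Q * V A * Q⁻¹ : Matrix.unitaryGroup (Fin e) ℂ) : Matrix (Fin e) (Fin e) ℂ) a b := by
      intro t ht hz a ha b hb
      obtain ⟨W, hW⟩ := exists_block_rep V Q t hz
      have hlt : Fintype.card t < e := by
        obtain ⟨c, hc⟩ := ht
        simpa using Fintype.card_subtype_lt (p := (· ∈ t)) hc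
      exact ⟨_, ih _ hlt W _ _, fun A => hW A ⟨a, ha⟩ ⟨b, hb⟩⟩
    have hR : ∀ a b, ∃ f ∈ coeffSpan U, ∀ A, f A =
        ((Q * V A * Q⁻¹ : Matrix.unitaryGroup (Fin e) ℂ) : Matrix (Fin e) (Fin e) ℂ) a b := by
      intro a b
      by_cases ha : a ∈ s <;> by_cases hb : b ∈ s
      · exact hmem s hs' (fun A a b h1 h2 => h A a b (by tauto)) a ha b hb
      · exact ⟨0, zero_mem _, fun A => (h A a b (by tauto)).symm⟩
      · exact ⟨0, zero_mem _, fun A => (h A a b (by tauto)).symm⟩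
      · refine hmem sᶜ (by simpa using hs) (fun A a b h1 h2 => h A a b ?_) a ha b hb
        simp only [Set.mem_compl_iff, not_not] at h1 h2
        tauto
    choose f hf hfR using hR
    have hsum : matrixCoeff V a b = ∑ n, ∑ m,
        (star (Q : Matrix (Fin e) (Fin e) ℂ) a m * (Q : Matrix (Fin e) (Fin e) ℂ) n b) • f m n := by
      ext A
      have h1 : V A = Q⁻¹ * (Q * V A * Q⁻¹) * Q := by group
      have h2 : (V A : Matrix (Fin e) (Fin e) ℂ) = star (Q : Matrix (Fin e) (Fin e) ℂ) *
          ((Q * V A * Q⁻¹ : Matrix.unitaryGroup (Fin e) ℂ) : Matrix (Fin e) (Fin e) ℂ) *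
          (Q : Matrix (Fin e) (Fin e) ℂ) := congrArg Subtype.val h1
      change (V A : Matrix (Fin e) (Fin e) ℂ) a b = _
      rw [h2, Matrix.mul_apply, ContinuousMap.sum_apply]
      refine Finset.sum_congr rfl fun n _ => ?_
      rw [Matrix.mul_apply, Finset.sum_mul, ContinuousMap.sum_apply]
      refine Finset.sum_congr rfl fun m _ => ?_
      rw [ContinuousMap.smul_apply, hfR, smul_eq_mul]
      ring
    rw [hsum]
    exact Submodule.sum_mem _ fun n _ => Submodule.sum_mem _ fun m _ =>
      Submodule.smul_mem _ _ (hf m n)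
  -- Irreducibility also requires `0 < e`, which the index `a : Fin e` supplies.
  · obtain ⟨l, T, -, hT2, hT⟩ := hU.exhaustive e V ⟨a.pos, hirr⟩
    have hsum : matrixCoeff V a b = ∑ k, ∑ m, (Tᴴ a m * T k b) • matrixCoeff (U l) m k := by
      ext A
      have h2 : (V A : Matrix (Fin e) (Fin e) ℂ) =
          Tᴴ * (U l A : Matrix (Fin (d l)) (Fin (d l)) ℂ) * T := by
        rw [Matrix.mul_assoc, hT, ← Matrix.mul_assoc, hT2, Matrix.one_mul]
      change (V A : Matrix (Fin e) (Fin e) ℂ) a b = _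
      rw [h2, Matrix.mul_apply, ContinuousMap.sum_apply]
      refine Finset.sum_congr rfl fun n _ => ?_
      rw [Matrix.mul_apply, Finset.sum_mul, ContinuousMap.sum_apply]
      refine Finset.sum_congr rfl fun m _ => ?_
      rw [ContinuousMap.smul_apply, smul_eq_mul]
      change _ = _ * (U l A : Matrix (Fin (d l)) (Fin (d l)) ℂ) m n
      ring
    rw [hsum]
    exact Submodule.sum_mem _ fun n _ => Submodule.sum_mem _ fun m _ =>
      Submodule.smul_mem _ _ (matrixCoeff_mem_coeffSpan_self U l m n)

theorem continuous_rep {e : ℕ} (V : G →ₜ* Matrix.unitaryGroup (Fin e) ℂ) :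
    Continuous fun A => (V A : Matrix (Fin e) (Fin e) ℂ) :=
  continuous_subtype_val.comp V.continuous_toFun

theorem one_mem_coeffSpan (hU : EnumeratesIURs U) : (1 : C(G, ℂ)) ∈ coeffSpan U := by
  obtain ⟨V, hV⟩ := exists_rep_of_family (fun _ : G => (1 : Matrix Unit Unit ℂ)) continuous_const
    (by simp) (fun _ => one_mem _)
  convert matrixCoeff_mem_coeffSpan hU V (Fintype.equivFin Unit ()) (Fintype.equivFin Unit ())
  ext A
  exact (hV A () ()).symm

/-- A product of two matrix coefficients is a coefficient of the tensor product, which need not be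
irreducible; complete reducibility brings it back into the span. -/
theorem mul_mem_coeffSpan (hU : EnumeratesIURs U) {f g : C(G, ℂ)} (hf : f ∈ coeffSpan U)
    (hg : g ∈ coeffSpan U) : f * g ∈ coeffSpan U := by
  have hle : coeffSpan U * coeffSpan U ≤ coeffSpan U := by
    refine (Submodule.span_mul_span ℂ _ _).trans_le (Submodule.span_le.mpr ?_)
    rintro _ ⟨_, ⟨⟨l, m, k⟩, rfl⟩, _, ⟨⟨l', m', k'⟩, rfl⟩, rfl⟩
    obtain ⟨V, hV⟩ := exists_rep_of_family (fun A : G =>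
      kroneckerMap (· * ·) (U l A : Matrix (Fin (d l)) (Fin (d l)) ℂ)
        (U l' A : Matrix (Fin (d l')) (Fin (d l')) ℂ))
      (by
        refine continuous_matrix fun i j => ?_
        exact (continuous_rep_apply (U l) _ _).mul (continuous_rep_apply (U l') _ _))
      (fun A B => by rw [rep_mul, rep_mul, mul_kronecker_mul])
      (fun A => kronecker_mem_unitary (U l A).2 (U l' A).2)
    have := matrixCoeff_mem_coeffSpan hU V (Fintype.equivFin _ (m, m')) (Fintype.equivFin _ (k, k'))
    have heq : matrixCoeff (U l) m k * matrixCoeff (U l') m' k' = matrixCoeff V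
        (Fintype.equivFin _ (m, m')) (Fintype.equivFin _ (k, k')) := by
      ext A
      exact (hV A (m, m') (k, k')).symm
    change matrixCoeff (U l) m k * matrixCoeff (U l') m' k' ∈ coeffSpan U
    rw [heq]
    exact this
  exact hle (Submodule.mul_mem_mul hf hg)

/-- The conjugate of a matrix coefficient is a coefficient of the conjugate representation. -/
theorem star_mem_coeffSpan (hU : EnumeratesIURs U) {f : C(G, ℂ)} (hf : f ∈ coeffSpan U) :
    star f ∈ coeffSpan U := by
  induction hf using Submodule.span_induction with
  | mem f hf =>
    obtain ⟨⟨l, m, k⟩, rfl⟩ := hf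
    obtain ⟨V, hV⟩ := exists_rep_of_family (fun A : G =>
      (U l A : Matrix (Fin (d l)) (Fin (d l)) ℂ).map star)
      ((continuous_rep (U l)).matrix_map continuous_star)
      (fun A B => by
        rw [rep_mul]
        exact Matrix.map_mul (f := starRingEnd ℂ))
      (fun A => Matrix.map_star_mem_unitaryGroup_iff.mpr (U l A).2)
    convert matrixCoeff_mem_coeffSpan hU V (Fintype.equivFin _ m) (Fintype.equivFin _ k)
    ext A
    exact (hV A m k).symm
  | zero => simp
  | add f g _ _ hf hg => rw [star_add]; exact add_mem hf hg
  | smul c f _ hf => rw [star_smul]; exact Submodule.smul_mem _ _ hf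

/-- If `G` has a faithful representation, then the matrix coefficients of the irreducible
representations span a dense subspace of `C(G, ℂ)`. -/
theorem coeffSpan_topologicalClosure_eq_top [CompactSpace G] (hU : EnumeratesIURs U) {e : ℕ}
    (V : G →ₜ* Matrix.unitaryGroup (Fin e) ℂ) (hV : Function.Injective V) :
    (coeffSpan U).topologicalClosure = ⊤ := by
  let S : StarSubalgebra ℂ C(G, ℂ) :=
    { carrier := coeffSpan U
      mul_mem' := mul_mem_coeffSpan hU
      add_mem' := add_mem
      algebraMap_mem' := fun c => by
        rw [Algebra.algebraMap_eq_smul_one]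
        exact Submodule.smul_mem _ _ (one_mem_coeffSpan hU)
      star_mem' := star_mem_coeffSpan hU }
  have hS : S.SeparatesPoints := by
    intro A B hAB
    have hne : V A ≠ V B := fun h => hAB (hV h)
    rw [Ne, Matrix.UnitaryGroup.ext_iff] at hne
    push Not at hne
    obtain ⟨i, j, hij⟩ := hne
    exact ⟨_, ⟨matrixCoeff V i j, matrixCoeff_mem_coeffSpan hU V i j, rfl⟩, hij⟩
  have htop := ContinuousMap.starSubalgebra_topologicalClosure_eq_top_of_separatesPoints S hS
  rw [eq_top_iff]
  intro f _
  have hf : f ∈ S.topologicalClosure := htop ▸ StarSubalgebra.mem_top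
  exact hf

/-- The span of the complex conjugates of the matrix coefficients of all irreducible
representations is the span of the matrix coefficients. -/
theorem coeffSpan_le_span_star (hU : EnumeratesIURs U) :
    coeffSpan U ≤ Submodule.span ℂ (Set.range fun p : (l : I) × (Fin (d l) × Fin (d l)) =>
      star (matrixCoeff (U p.1) p.2.1 p.2.2)) := by
  have h : ∀ f ∈ coeffSpan U, star f ∈ Submodule.span ℂ
      (Set.range fun p : (l : I) × (Fin (d l) × Fin (d l)) =>
        star (matrixCoeff (U p.1) p.2.1 p.2.2)) := by
    intro f hf
    induction hf using Submodule.span_induction with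
    | mem f hf =>
      obtain ⟨p, rfl⟩ := hf
      exact Submodule.subset_span ⟨p, rfl⟩
    | zero => simp
    | add f g _ _ hf hg => rw [star_add]; exact add_mem hf hg
    | smul c f _ hf => rw [star_smul]; exact Submodule.smul_mem _ _ hf
  intro f hf
  simpa using h _ (star_mem_coeffSpan hU hf)

end coefficients

/-! ### Inversion invariance of the normalized Haar measure. -/

section haar

variable {G : Type*} [Group G] [TopologicalSpace G] [IsTopologicalGroup G] [CompactSpace G]
  [MeasurableSpace G] [BorelSpace G] (η : Measure G) [IsProbabilityMeasure η]
  [η.IsMulLeftInvariant]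

theorem isHaarMeasure_of_isProbabilityMeasure : η.IsHaarMeasure :=
  Measure.isHaarMeasure_of_isCompact_nonempty_interior η Set.univ isCompact_univ (by simp)
    (by simp) (by simp)

/-- An invariant probability measure on a compact group is invariant under inversion. -/
theorem isInvInvariant_of_isProbabilityMeasure : η.IsInvInvariant := by
  have huniq : ∀ μ : Measure G, IsProbabilityMeasure μ → μ.IsMulLeftInvariant → μ = η := by
    intro μ _ _
    have := isHaarMeasure_of_isProbabilityMeasure μ
    have := isHaarMeasure_of_isProbabilityMeasure η
    exact Measure.isHaarMeasure_eq_of_isProbabilityMeasure μ η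
  -- Right translates of `η` stay left-invariant, so uniqueness gives right invariance. That makes
  -- the image under inversion left-invariant, and uniqueness applies again.
  have hr : η.IsMulRightInvariant := by
    refine ⟨fun g => huniq _ ?_ ?_⟩
    · exact Measure.isProbabilityMeasure_map (by fun_prop)
    · infer_instance
  refine ⟨huniq _ ?_ ?_⟩
  · exact Measure.isProbabilityMeasure_map (by fun_prop)
  · infer_instance

end haar

namespace GInvariantGraph

/-! ### Integral and diagonal operators on `L²([N] × G)`. -/

section abstractGroup

variable {N : ℕ} {G : Type*} [TopologicalSpace G] [CompactSpace G]
  [MeasurableSpace G] [BorelSpace G] (η : Measure G) [IsProbabilityMeasure η]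

theorem toH_apply (f : Fin N → C(G, ℂ)) (i : Fin N) :
    toH η f i = ContinuousMap.toLp 2 η ℂ (f i) := rfl

/-- `toH` as a linear map. -/
noncomputable def toHLinear : (Fin N → C(G, ℂ)) →ₗ[ℂ] H N η where
  toFun := toH η
  map_add' f g := by
    ext1 i
    simp [toH]
  map_smul' c f := by
    ext1 i
    simp [toH]

/-- The inclusion of `L²(G)` into `L²([N] × G)` as the `i`-th component. -/
noncomputable def singleH (i : Fin N) : Lp ℂ 2 η →L[ℂ] H N η :=
  (PiLp.continuousLinearEquiv 2 ℂ (fun _ : Fin N => Lp ℂ 2 η)).symm.toContinuousLinearMap ∘L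
    ContinuousLinearMap.single ℂ (fun _ : Fin N => Lp ℂ 2 η) i

omit [TopologicalSpace G] [CompactSpace G] [BorelSpace G] [IsProbabilityMeasure η] in
theorem sum_singleH (h : H N η) : ∑ i, singleH η i (h i) = h := by
  ext1 j
  simp [singleH, Finset.sum_pi_single]

theorem singleH_toLp (i : Fin N) (f : C(G, ℂ)) :
    singleH η i (ContinuousMap.toLp 2 η ℂ f) = toH η (Pi.single i f) := by
  ext1 j
  rw [toH_apply]
  by_cases hj : j = i
  · subst hj
    simp [singleH]
  · simp [singleH, hj]

theorem integralAgainst_toLp (k : C(G × G, ℂ)) (f : C(G, ℂ)) (A : G) :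
    integralAgainst η k (ContinuousMap.toLp 2 η ℂ f) A = ∫ B, k (A, B) * f B ∂η := by
  refine integral_congr_ae ?_
  filter_upwards [ContinuousMap.coeFn_toLp (𝕜 := ℂ) (p := 2) η f] with B hB
  rw [hB]

theorem kernelOp_toH (k : Fin N → Fin N → C(G × G, ℂ)) (f g : Fin N → C(G, ℂ))
    (h : ∀ i A, g i A = ∑ j, ∫ B, k i j (A, B) * f j B ∂η) :
    kernelOp η k (toH η f) = toH η g := by
  change toH η (fun i => ∑ j, integralAgainst η (k i j) (toH η f j)) = _
  congr 1
  ext i A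
  rw [ContinuousMap.sum_apply, h]
  exact Finset.sum_congr rfl fun j _ => integralAgainst_toLp η _ _ _

theorem diagOp_toH (c : Fin N → ℝ) (f : Fin N → C(G, ℂ)) :
    diagOp η c (toH η f) = toH η (fun i => (c i : ℂ) • f i) := by
  ext1 i
  exact (map_smul (ContinuousMap.toLp 2 η ℂ) (c i : ℂ) (f i)).symm

theorem inner_toH (f g : Fin N → C(G, ℂ)) :
    inner ℂ (toH η f) (toH η g) = ∑ i, ∫ A, conj (f i A) * g i A ∂η := by
  rw [PiLp.inner_apply]
  refine Finset.sum_congr rfl fun i _ => ?_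
  rw [toH_apply, toH_apply, ContinuousMap.inner_toLp]
  simp only [mul_comm]

/-- An integral operator with a Hermitian kernel is symmetric. -/
theorem kernelOp_isSymmetric [SecondCountableTopology G] (k : Fin N → Fin N → C(G × G, ℂ))
    (hk : ∀ i j A B, conj (k i j (A, B)) = k j i (B, A)) : (kernelOp η k).IsSymmetric := by
  intro f g
  -- Hypothesis of Fubini: the kernel is bounded, and `L²` functions are integrable for a
  -- probability measure.
  have hint : ∀ (i j : Fin N) (u v : Lp ℂ 2 η),
      Integrable (fun p : G × G => k i j (p.1, p.2) * (conj (u p.1) * v p.2)) (η.prod η) := by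
    intro i j u v
    have hu : Integrable u η := (Lp.memLp u).integrable (by norm_num)
    have hv : Integrable v η := (Lp.memLp v).integrable (by norm_num)
    have hu' : Integrable (fun A => conj (u A)) η := by
      exact (Complex.conjCLE.toContinuousLinearMap.integrable_comp hu)
    refine (hu'.mul_prod hv).bdd_mul (c := ‖k i j‖) ?_
      (Filter.Eventually.of_forall fun p => (k i j).norm_coe_le_norm _)
    exact (k i j).continuous.aestronglyMeasurable
  have hcomp : ∀ (i j : Fin N) (u v : Lp ℂ 2 η),
      inner ℂ u (ContinuousMap.toLp 2 η ℂ (integralAgainst η (k i j) v)) =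
        ∫ A, ∫ B, k i j (A, B) * (conj (u A) * v B) ∂η ∂η := by
    intro i j u v
    rw [L2.inner_def]
    refine integral_congr_ae ?_
    filter_upwards [ContinuousMap.coeFn_toLp (𝕜 := ℂ) (p := 2) η (integralAgainst η (k i j) v)]
      with A hA
    rw [hA, RCLike.inner_apply]
    change (∫ B, k i j (A, B) * v B ∂η) * conj (u A) = _
    rw [← integral_mul_const]
    congr 1
    ext B
    ring
  have hterm : ∀ (i j : Fin N) (u v : Lp ℂ 2 η),
      inner ℂ (ContinuousMap.toLp 2 η ℂ (integralAgainst η (k i j) v)) u =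
        inner ℂ v (ContinuousMap.toLp 2 η ℂ (integralAgainst η (k j i) u)) := by
    intro i j u v
    rw [← inner_conj_symm, hcomp, hcomp, integral_integral_swap (hint i j u v), ← integral_conj]
    congr 1
    ext A
    rw [← integral_conj]
    congr 1
    ext B
    rw [map_mul, map_mul, hk, RCLike.conj_conj]
    ring
  rw [PiLp.inner_apply, PiLp.inner_apply]
  have hl : ∀ i, inner ℂ (kernelOp η k f i) (g i) = ∑ j,
      inner ℂ (ContinuousMap.toLp 2 η ℂ (integralAgainst η (k i j) (f j))) (g i) := by
    intro i
    change inner ℂ (ContinuousMap.toLp 2 η ℂ (∑ j, integralAgainst η (k i j) (f j))) (g i) = _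
    rw [map_sum, sum_inner]
  have hr : ∀ i, inner ℂ (f i) (kernelOp η k g i) = ∑ j,
      inner ℂ (f i) (ContinuousMap.toLp 2 η ℂ (integralAgainst η (k i j) (g j))) := by
    intro i
    change inner ℂ (f i) (ContinuousMap.toLp 2 η ℂ (∑ j, integralAgainst η (k i j) (g j))) = _
    rw [map_sum, inner_sum]
  simp_rw [hl, hr, hterm]
  exact Finset.sum_comm

end abstractGroup

/-! ### Inner products of the functions `eigenFun U m v`. -/

section eigenFun

variable {N : ℕ} {G : Type*} [Group G] [TopologicalSpace G] {d : ℕ}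
  (U : G →ₜ* Matrix.unitaryGroup (Fin d) ℂ) (m : Fin d)

theorem eigenFun_apply (v : Fin N × Fin d → ℂ) (i : Fin N) (A : G) :
    eigenFun U m v i A = (Real.sqrt d : ℂ) *
      ∑ k : Fin d, conj ((U A : Matrix (Fin d) (Fin d) ℂ) m k) * v (i, k) := rfl

/-- The functions `eigenFun U m v` depend linearly on `v`. -/
noncomputable def eigenFunLinear : (Fin N × Fin d → ℂ) →ₗ[ℂ] (Fin N → C(G, ℂ)) where
  toFun := eigenFun U m
  map_add' v w := by
    ext i A
    simp [eigenFun_apply, mul_add, Finset.sum_add_distrib]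
  map_smul' c v := by
    ext i A
    simp only [eigenFun_apply, Pi.smul_apply, smul_eq_mul, RingHom.id_apply,
      ContinuousMap.smul_apply, Finset.mul_sum]
    exact Finset.sum_congr rfl fun k _ => by ring

/-- Standard basis vectors recover conjugated matrix coefficients in a single component, which is
how completeness is reduced to density in `C(G, ℂ)`. -/
theorem eigenFun_single (i₀ : Fin N) (k : Fin d) :
    eigenFun U m (Pi.single (i₀, k) 1) =
      Pi.single i₀ ((Real.sqrt d : ℂ) • star (matrixCoeff U m k)) := by
  ext i A
  rw [eigenFun_apply]
  by_cases hi : i = i₀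
  · subst hi
    simp [Pi.single_apply, matrixCoeff]
  · simp [hi]

variable [IsTopologicalGroup G] [CompactSpace G] [MeasurableSpace G] [BorelSpace G]
  (η : Measure G) [IsProbabilityMeasure η]

omit [IsTopologicalGroup G] in
theorem diagOp_eigenFun (c : Fin N → ℝ) (v : Fin N × Fin d → ℂ) :
    diagOp η c (toH η (eigenFun U m v)) = toH η (eigenFun U m fun p => (c p.1 : ℂ) * v p) := by
  rw [diagOp_toH]
  congr 1
  ext i A
  simp only [ContinuousMap.smul_apply, eigenFun_apply, smul_eq_mul, Finset.mul_sum]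
  exact Finset.sum_congr rfl fun k _ => by ring

omit [IsTopologicalGroup G] in
theorem inner_eigenFun {e : ℕ} (V : G →ₜ* Matrix.unitaryGroup (Fin e) ℂ) (m' : Fin e)
    (v : Fin N × Fin d → ℂ) (w : Fin N × Fin e → ℂ) :
    inner ℂ (toH η (eigenFun U m v)) (toH η (eigenFun V m' w)) =
      ∑ i, ∑ k, ∑ k', (Real.sqrt d * Real.sqrt e : ℂ) * (conj (v (i, k)) * w (i, k')) *
        ∫ A, (U A : Matrix (Fin d) (Fin d) ℂ) m k *
          conj ((V A : Matrix (Fin e) (Fin e) ℂ) m' k') ∂η := by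
  rw [inner_toH]
  refine Finset.sum_congr rfl fun i _ => ?_
  have hpt : ∀ A, conj (eigenFun U m v i A) * eigenFun V m' w i A = ∑ k, ∑ k',
      (Real.sqrt d * Real.sqrt e : ℂ) * (conj (v (i, k)) * w (i, k')) *
        ((U A : Matrix (Fin d) (Fin d) ℂ) m k *
          conj ((V A : Matrix (Fin e) (Fin e) ℂ) m' k')) := by
    intro A
    rw [eigenFun_apply, eigenFun_apply, map_mul, map_sum, Complex.conj_ofReal, mul_mul_mul_comm,
      Finset.sum_mul_sum, Finset.mul_sum]
    refine Finset.sum_congr rfl fun k _ => ?_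
    rw [Finset.mul_sum]
    refine Finset.sum_congr rfl fun k' _ => ?_
    rw [map_mul, Complex.conj_conj]
    ring
  have hint : ∀ k k', Integrable (fun A =>
      (Real.sqrt d * Real.sqrt e : ℂ) * (conj (v (i, k)) * w (i, k')) *
        ((U A : Matrix (Fin d) (Fin d) ℂ) m k *
          conj ((V A : Matrix (Fin e) (Fin e) ℂ) m' k'))) η := by
    intro k k'
    apply integrable_of_continuous
    have := continuous_rep_apply U m k
    have := continuous_rep_apply V m' k'
    fun_prop
  simp_rw [hpt]
  rw [integral_finsetSum _ fun k _ => integrable_finsetSum _ fun k' _ => hint k k']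
  refine Finset.sum_congr rfl fun k _ => ?_
  rw [integral_finsetSum _ fun k' _ => hint k k']
  exact Finset.sum_congr rfl fun k' _ => integral_const_mul _ _

variable [η.IsMulLeftInvariant]

variable {U} in
theorem inner_eigenFun_eq_zero {e : ℕ} {V : G →ₜ* Matrix.unitaryGroup (Fin e) ℂ}
    (hU : IsIrreducibleRep U) (hV : IsIrreducibleRep V) (hUV : ¬ AreEquivalentReps U V)
    (m' : Fin e) (v : Fin N × Fin d → ℂ) (w : Fin N × Fin e → ℂ) :
    inner ℂ (toH η (eigenFun U m v)) (toH η (eigenFun V m' w)) = 0 := by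
  simp [inner_eigenFun, integral_rep_mul_conj_eq_zero η hU hV hUV]

variable {U} in
-- The normalization `√d * √d` cancels the `1/d` of Schur orthogonality, leaving the inner product
-- of `ℂ^{Nd}`.
theorem inner_eigenFun_self (hU : IsIrreducibleRep U) (m' : Fin d) (v w : Fin N × Fin d → ℂ) :
    inner ℂ (toH η (eigenFun U m v)) (toH η (eigenFun U m' w)) =
      if m = m' then ∑ p, conj (v p) * w p else 0 := by
  rw [inner_eigenFun]
  simp_rw [integral_rep_mul_conj_self η hU]
  have hd : (Real.sqrt d * Real.sqrt d : ℂ) = d := by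
    rw [← Complex.ofReal_mul, Real.mul_self_sqrt (Nat.cast_nonneg d), Complex.ofReal_natCast]
  have hd0 : (d : ℂ) ≠ 0 := by exact_mod_cast hU.1.ne'
  split_ifs with h
  · rw [Fintype.sum_prod_type]
    refine Finset.sum_congr rfl fun i _ => Finset.sum_congr rfl fun k _ => ?_
    simp only [h, true_and, mul_ite, mul_zero, Finset.sum_ite_eq, Finset.mem_univ, if_true, hd]
    field_simp
  · simp [h]

end eigenFun

end GInvariantGraph

/-! ### Invariance of the affinities and reduction of `W` to finite matrices. -/

namespace GInvariantGraph

variable {N q : ℕ} {G : Subgroup (Matrix.unitaryGroup (Fin q) ℂ)}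

/-- Makes continuous kernels on `G × G` measurable for the product σ-algebra, as Fubini needs in
`kernelOp_isSymmetric`. -/
theorem secondCountableTopology_subgroup : SecondCountableTopology G := by
  have : SecondCountableTopology (Matrix (Fin q) (Fin q) ℂ) :=
    inferInstanceAs (SecondCountableTopology (Fin q → Fin q → ℂ))
  have : SecondCountableTopology (Matrix.unitaryGroup (Fin q) ℂ) :=
    Topology.IsEmbedding.subtypeVal.secondCountableTopology
  exact Topology.IsEmbedding.subtypeVal.secondCountableTopology

theorem act_mul (A B : G) (y : EuclideanSpace ℂ (Fin q)) : act (A * B) y = act A (act B y) := by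
  simp [act, Matrix.toEuclideanLin]

theorem norm_act (A : G) (y : EuclideanSpace ℂ (Fin q)) : ‖act A y‖ = ‖y‖ := by
  have h : ((A : Matrix.unitaryGroup (Fin q) ℂ) : Matrix (Fin q) (Fin q) ℂ) ∈
    Matrix.unitaryGroup (Fin q) ℂ := (A : Matrix.unitaryGroup (Fin q) ℂ).2
  have hinner : inner ℂ (act A y) (act A y) = inner ℂ y y := by
    rw [EuclideanSpace.inner_eq_star_dotProduct, EuclideanSpace.inner_eq_star_dotProduct]
    simp only [act, Matrix.toEuclideanLin, Matrix.toLpLin_apply]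
    rw [Matrix.star_mulVec, dotProduct_comm, ← Matrix.dotProduct_mulVec, Matrix.mulVec_mulVec,
      ← star_eq_conjTranspose, Matrix.mem_unitaryGroup_iff'.mp h, Matrix.one_mulVec,
      dotProduct_comm]
  rw [inner_self_eq_norm_sq_to_K, inner_self_eq_norm_sq_to_K] at hinner
  exact (sq_eq_sq₀ (norm_nonneg _) (norm_nonneg _)).mp (by exact_mod_cast hinner)

variable (ε : ℝ) (x : Fin N → EuclideanSpace ℂ (Fin q))

theorem W_mul_left (C : G) (i j : Fin N) (A B : G) :
    W ε x i j (C * A, C * B) = W ε x i j (A, B) := by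
  change Real.exp (-‖act (C * A) (x i) - act (C * B) (x j)‖ ^ 2 / ε) =
    Real.exp (-‖act A (x i) - act B (x j)‖ ^ 2 / ε)
  have h : act (C * A) (x i) - act (C * B) (x j) = act C (act A (x i) - act B (x j)) := by
    rw [act_mul, act_mul]
    exact (map_sub _ _ _).symm
  rw [h, norm_act]

theorem W_symm (i j : Fin N) (A B : G) : W ε x i j (A, B) = W ε x j i (B, A) := by
  change Real.exp (-‖act A (x i) - act B (x j)‖ ^ 2 / ε) =
    Real.exp (-‖act B (x j) - act A (x i)‖ ^ 2 / ε)
  rw [norm_sub_rev]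

theorem W_one_inv (i j : Fin N) (A : G) : W ε x i j (1, A⁻¹) = W ε x j i (1, A) := by
  rw [← W_mul_left ε x A, mul_one, mul_inv_cancel, W_symm]

variable [MeasurableSpace G] [BorelSpace G] [CompactSpace G] (η : Measure G)
  [IsProbabilityMeasure η]

theorem D_pos (i : Fin N) : 0 < D η ε x i := by
  refine Finset.sum_pos (fun j _ => ?_) ⟨i, Finset.mem_univ i⟩
  refine integral_exp_pos ?_
  have hc : Continuous fun C : G => W ε x i j (1, C) :=
    (W ε x i j).continuous.comp (by fun_prop)
  exact hc.integrable_of_hasCompactSupport (HasCompactSupport.of_compactSpace _)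

theorem opS_eq :
    opS η ε x = diagOp η (fun i => (Real.sqrt (D η ε x i))⁻¹) ∘ₗ opW η ε x ∘ₗ
      diagOp η (fun i => (Real.sqrt (D η ε x i))⁻¹) := by
  have hk : ∀ i j (f : Lp ℂ 2 η), integralAgainst η (SKernel η ε x i j) f =
      (((Real.sqrt (D η ε x i))⁻¹ : ℝ) : ℂ) • (((Real.sqrt (D η ε x j))⁻¹ : ℝ) : ℂ) •
        integralAgainst η (WKernel ε x i j) f := by
    intro i j f
    ext A
    change ∫ B, ((W ε x i j (A, B) / (Real.sqrt (D η ε x i) * Real.sqrt (D η ε x j)) : ℝ) : ℂ) *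
      f B ∂η = (((Real.sqrt (D η ε x i))⁻¹ : ℝ) : ℂ) * ((((Real.sqrt (D η ε x j))⁻¹ : ℝ) : ℂ) *
        ∫ B, (W ε x i j (A, B) : ℂ) * f B ∂η)
    rw [← integral_const_mul, ← integral_const_mul]
    congr 1
    ext B
    push_cast
    rw [div_eq_mul_inv, mul_inv]
    ring
  ext f i : 2
  change ContinuousMap.toLp 2 η ℂ (∑ j, integralAgainst η (SKernel η ε x i j) (f j)) =
    (((Real.sqrt (D η ε x i))⁻¹ : ℝ) : ℂ) • ContinuousMap.toLp 2 η ℂ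
      (∑ j, integralAgainst η (WKernel ε x i j) ((((Real.sqrt (D η ε x j))⁻¹ : ℝ) : ℂ) • f j))
  rw [← map_smul, Finset.smul_sum]
  congr 1
  refine Finset.sum_congr rfl fun j _ => ?_
  rw [hk, integralAgainst_smul]

theorem opS_isSymmetric : (opS η ε x).IsSymmetric := by
  have := secondCountableTopology_subgroup (G := G)
  refine kernelOp_isSymmetric η _ fun i j A B => ?_
  change conj ((W ε x i j (A, B) / (Real.sqrt (D η ε x i) * Real.sqrt (D η ε x j)) : ℝ) : ℂ) =
    ((W ε x j i (B, A) / (Real.sqrt (D η ε x j) * Real.sqrt (D η ε x i)) : ℝ) : ℂ)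
  rw [Complex.conj_ofReal, W_symm, mul_comm]

variable {d : ℕ} (U : G →ₜ* Matrix.unitaryGroup (Fin d) ℂ)

omit [MeasurableSpace G] [BorelSpace G] [CompactSpace G] in
theorem continuous_W_one_mul_conj (i j : Fin N) (a b : Fin d) :
    Continuous fun A : G => (W ε x i j (1, A) : ℂ) *
      conj ((U A : Matrix (Fin d) (Fin d) ℂ) a b) := by
  have h1 : Continuous fun C : G => W ε x i j (1, C) :=
    (W ε x i j).continuous.comp (by fun_prop)
  have h2 := continuous_rep_apply U a b
  fun_prop

theorem K_mulVec (w : Fin N × Fin d → ℂ) (p : Fin N × Fin d) :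
    (K η ε x U *ᵥ w) p = w p - ((D η ε x p.1)⁻¹ : ℂ) * (WHat η ε x U *ᵥ w) p := by
  have hinv : (DBlock η ε x d)⁻¹ =
      Matrix.diagonal fun p : Fin N × Fin d => ((D η ε x p.1)⁻¹ : ℂ) := by
    refine Matrix.inv_eq_left_inv ?_
    rw [DBlock, Matrix.diagonal_mul_diagonal, ← Matrix.diagonal_one]
    congr 1
    ext p
    exact inv_mul_cancel₀ (by exact_mod_cast (D_pos ε x η p.1).ne')
  rw [K, Matrix.sub_mulVec, Matrix.one_mulVec, hinv, ← Matrix.mulVec_mulVec, Pi.sub_apply,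
    Matrix.mulVec_diagonal]

variable [η.IsMulLeftInvariant]

/-- After `B ↦ A * B` the kernel no longer depends on `A`, and `conj (U (A * B))` factors as a
matrix product. -/
theorem integral_W_mul_conj (i j : Fin N) (A : G) (m k : Fin d) :
    ∫ B, (W ε x i j (A, B) : ℂ) * conj ((U B : Matrix (Fin d) (Fin d) ℂ) m k) ∂η =
      ∑ r, conj ((U A : Matrix (Fin d) (Fin d) ℂ) m r) * WHat η ε x U (i, r) (j, k) := by
  rw [← integral_mul_left_eq_self _ A]
  have hpt : ∀ B, (W ε x i j (A, A * B) : ℂ) *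
      conj ((U (A * B) : Matrix (Fin d) (Fin d) ℂ) m k) =
      ∑ r, conj ((U A : Matrix (Fin d) (Fin d) ℂ) m r) * ((W ε x i j (1, B) : ℂ) *
        conj ((U B : Matrix (Fin d) (Fin d) ℂ) r k)) := by
    intro B
    have hW := W_mul_left ε x A i j 1 B
    rw [mul_one] at hW
    rw [hW, rep_mul, Matrix.mul_apply, map_sum, Finset.mul_sum]
    refine Finset.sum_congr rfl fun r _ => ?_
    rw [map_mul]
    ring
  simp_rw [hpt]
  rw [integral_finsetSum]
  · exact Finset.sum_congr rfl fun r _ => integral_const_mul _ _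
  · intro r _
    exact (integrable_of_continuous η (continuous_W_one_mul_conj ε x U i j r k)).const_mul _

theorem opW_eigenFun (m : Fin d) (v : Fin N × Fin d → ℂ) :
    opW η ε x (toH η (eigenFun U m v)) = toH η (eigenFun U m (WHat η ε x U *ᵥ v)) := by
  refine kernelOp_toH η _ _ _ fun i A => ?_
  have hterm : ∀ j, ∫ B, WKernel ε x i j (A, B) * eigenFun U m v j B ∂η =
      (Real.sqrt d : ℂ) * ∑ k, ∑ r, conj ((U A : Matrix (Fin d) (Fin d) ℂ) m r) *
        (WHat η ε x U (i, r) (j, k) * v (j, k)) := by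
    intro j
    have hpt : ∀ B, WKernel ε x i j (A, B) * eigenFun U m v j B = (Real.sqrt d : ℂ) * ∑ k,
        ((W ε x i j (A, B) : ℂ) * conj ((U B : Matrix (Fin d) (Fin d) ℂ) m k)) * v (j, k) := by
      intro B
      change (W ε x i j (A, B) : ℂ) * _ = _
      rw [eigenFun_apply, mul_left_comm, Finset.mul_sum]
      simp only [mul_assoc]
    simp_rw [hpt]
    rw [integral_const_mul, integral_finsetSum]
    · congr 1
      refine Finset.sum_congr rfl fun k _ => ?_
      rw [integral_mul_const, integral_W_mul_conj, Finset.sum_mul]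
      simp only [mul_assoc]
    · intro k _
      apply integrable_of_continuous
      have h1 : Continuous fun B : G => W ε x i j (A, B) :=
        (W ε x i j).continuous.comp (by fun_prop)
      have h2 := continuous_rep_apply U m k
      fun_prop
  simp_rw [hterm]
  rw [eigenFun_apply, ← Finset.mul_sum]
  congr 1
  simp_rw [Matrix.mulVec, dotProduct, Fintype.sum_prod_type, Finset.mul_sum]
  rw [Finset.sum_comm]
  exact Finset.sum_congr rfl fun j _ => Finset.sum_comm

/-- Under `A ↦ A⁻¹` the affinity swaps its indices `i`, `j` and `U A` becomes its adjoint, while `η`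
is unchanged. -/
theorem WHat_isHermitian : (WHat η ε x U).IsHermitian := by
  have := isInvInvariant_of_isProbabilityMeasure η
  ext p r
  rw [conjTranspose_apply, WHat, WHat, ← integral_inv_eq_self, RCLike.star_def, ← integral_conj]
  congr 1
  ext A
  rw [W_one_inv, map_mul, Complex.conj_conj, Complex.conj_ofReal, ← rep_conjTranspose,
    conjTranspose_apply]
  rfl

theorem exists_isEigenSystem : ∃ lamT vT, IsEigenSystem η ε x U lamT vT := by
  have hD : ∀ i, (Real.sqrt (D η ε x i) : ℂ) ≠ 0 := fun i => by
    exact_mod_cast (Real.sqrt_pos.mpr (D_pos ε x η i)).ne'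
  have hDD : ∀ i, (Real.sqrt (D η ε x i) : ℂ) * Real.sqrt (D η ε x i) = D η ε x i := fun i => by
    exact_mod_cast Real.mul_self_sqrt (D_pos ε x η i).le
  -- `X = D^{-1/2} Ŵ D^{-1/2}` is Hermitian and similar to `D⁻¹ Ŵ`: if `b` is an eigenvector of `X`,
  -- then `D^{-1/2} b` is one of `K`, with eigenvalue one minus that of `X`.
  let X : Matrix (Fin N × Fin d) (Fin N × Fin d) ℂ := fun p r =>
    (Real.sqrt (D η ε x p.1) : ℂ)⁻¹ * WHat η ε x U p r * (Real.sqrt (D η ε x r.1) : ℂ)⁻¹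
  have hX : X.IsHermitian := by
    ext p r
    have h := congrFun (congrFun (WHat_isHermitian ε x η U) p) r
    rw [conjTranspose_apply] at h ⊢
    have hs : ∀ i, star (Real.sqrt (D η ε x i) : ℂ)⁻¹ = (Real.sqrt (D η ε x i) : ℂ)⁻¹ := fun i => by
      rw [← Complex.ofReal_inv]
      exact Complex.conj_ofReal _
    simp only [X]
    rw [star_mul', star_mul', h, hs, hs]
    ring
  let e : Fin (N * d) ≃ Fin N × Fin d := finProdFinEquiv.symm
  let b := hX.eigenvectorBasis
  let vT : Fin (N * d) → Fin N × Fin d → ℂ := fun n p =>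
    (Real.sqrt (D η ε x p.1) : ℂ)⁻¹ * b (e n) p
  have hvT : ∀ n, DBlockSqrt η ε x d *ᵥ vT n = (b (e n)).ofLp := by
    intro n
    ext p
    rw [DBlockSqrt, Matrix.mulVec_diagonal, mul_inv_cancel_left₀ (hD _)]
  refine ⟨fun n => 1 - hX.eigenvalues (e n), vT, fun n => ?_, ?_⟩
  · rw [Module.End.hasEigenvector_iff, Module.End.mem_eigenspace_iff]
    refine ⟨?_, ?_⟩
    · rw [Matrix.toLin'_apply]
      ext p
      have hb := congrFun (hX.mulVec_eigenvectorBasis (e n)) p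
      have hX' : (X *ᵥ (b (e n)).ofLp) p =
          (Real.sqrt (D η ε x p.1) : ℂ)⁻¹ * (WHat η ε x U *ᵥ vT n) p := by
        simp only [Matrix.mulVec, dotProduct, Finset.mul_sum, X, vT]
        exact Finset.sum_congr rfl fun r _ => by ring
      rw [hX', Pi.smul_apply] at hb
      rw [K_mulVec, ← hDD, mul_inv, mul_assoc, hb]
      simp only [vT, Pi.smul_apply, smul_eq_mul, Complex.real_smul]
      push_cast
      ring
    · intro h0
      have h1 := hvT n
      rw [h0, Matrix.mulVec_zero] at h1
      exact b.orthonormal.ne_zero (e n) (by ext p; exact (congrFun h1 p).symm)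
  · simp_rw [hvT]
    exact b.orthonormal.comp e e.injective

end GInvariantGraph

/-! ### Completeness, eigenvalue equations and orthonormality. -/

namespace GInvariantGraph

theorem toH_eigenFun_smul {N : ℕ} {G : Type*} [Group G] [TopologicalSpace G] [CompactSpace G]
    [MeasurableSpace G] [BorelSpace G] (η : Measure G) [IsProbabilityMeasure η] {d : ℕ}
    (U : G →ₜ* Matrix.unitaryGroup (Fin d) ℂ) (m : Fin d) (c : ℂ) (v : Fin N × Fin d → ℂ) :
    toH η (eigenFun U m (c • v)) = c • toH η (eigenFun U m v) :=
  (toHLinear η ∘ₗ eigenFunLinear U m).map_smul c v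

/-- If `G` has a faithful representation, then a closed subspace of `L²([N] × G)` that contains
all the functions `eigenFun (U l) m w` is the whole space. -/
theorem eq_top_of_toH_eigenFun_mem {N : ℕ} {G : Type*} [Group G] [TopologicalSpace G]
    [IsTopologicalGroup G] [T2Space G] [CompactSpace G] [MeasurableSpace G] [BorelSpace G]
    (η : Measure G) [IsProbabilityMeasure η] [η.IsMulLeftInvariant] {I : Type*} {d : I → ℕ}
    {U : ∀ l : I, G →ₜ* Matrix.unitaryGroup (Fin (d l)) ℂ} (hU : EnumeratesIURs U) {e : ℕ}
    (V : G →ₜ* Matrix.unitaryGroup (Fin e) ℂ) (hV : Function.Injective V)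
    (S : Submodule ℂ (H N η)) (hS : IsClosed (S : Set (H N η)))
    (hmem : ∀ l m w, toH η (eigenFun (U l) m w) ∈ S) : S = ⊤ := by
  have hC : ∀ i (f : C(G, ℂ)), singleH η i (ContinuousMap.toLp 2 η ℂ f) ∈ S := by
    intro i
    let J : C(G, ℂ) →L[ℂ] H N η := singleH η i ∘L ContinuousMap.toLp 2 η ℂ
    have hspan : coeffSpan U ≤ S.comap J.toLinearMap := by
      refine (coeffSpan_le_span_star hU).trans (Submodule.span_le.mpr ?_)
      rintro _ ⟨⟨l, m, k⟩, rfl⟩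
      have h := hmem l m (Pi.single (i, k) 1)
      rw [eigenFun_single, ← singleH_toLp, map_smul, map_smul] at h
      have hd : (Real.sqrt (d l) : ℂ) ≠ 0 := by
        exact_mod_cast (Real.sqrt_pos.mpr (Nat.cast_pos.mpr (hU.irreducible l).1)).ne'
      exact (S.smul_mem_iff hd).mp h
    have htop : S.comap J.toLinearMap = ⊤ := by
      rw [eq_top_iff, ← coeffSpan_topologicalClosure_eq_top hU V hV]
      exact Submodule.topologicalClosure_minimal _ hspan (hS.preimage J.continuous)
    intro f
    exact (htop ▸ Submodule.mem_top : f ∈ S.comap J.toLinearMap)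
  have hL : ∀ i (u : Lp ℂ 2 η), singleH η i u ∈ S := by
    intro i u
    -- A Haar measure on a compact group is regular, whence continuous functions are dense in `L²`.
    have := isHaarMeasure_of_isProbabilityMeasure η
    exact (ContinuousMap.toLp_denseRange ℂ η ℂ (by norm_num)).induction_on u
      (hS.preimage (singleH η i).continuous) (hC i)
  rw [eq_top_iff]
  intro h _
  rw [← sum_singleH η h]
  exact Submodule.sum_mem _ fun i _ => hL i _

variable {N q : ℕ} {G : Subgroup (Matrix.unitaryGroup (Fin q) ℂ)}
  [MeasurableSpace G] [BorelSpace G] [CompactSpace G] {η : Measure G}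
  [IsProbabilityMeasure η] {ε : ℝ} {x : Fin N → EuclideanSpace ℂ (Fin q)}

omit [BorelSpace G] [CompactSpace G] [IsProbabilityMeasure η] in
theorem DBlockSqrt_mulVec {d : ℕ} (w : Fin N × Fin d → ℂ) :
    DBlockSqrt η ε x d *ᵥ w = fun p => (Real.sqrt (D η ε x p.1) : ℂ) * w p := by
  ext p
  rw [DBlockSqrt, Matrix.mulVec_diagonal]

namespace IsEigenSystem

variable {d : ℕ} {U : G →ₜ* Matrix.unitaryGroup (Fin d) ℂ} {lamT : Fin (N * d) → ℝ}
  {vT : Fin (N * d) → Fin N × Fin d → ℂ} (h : IsEigenSystem η ε x U lamT vT)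

include h

theorem inv_D_mul_WHat_mulVec (n : Fin (N * d)) (p : Fin N × Fin d) :
    ((D η ε x p.1)⁻¹ : ℂ) * (WHat η ε x U *ᵥ vT n) p = ((1 - lamT n : ℝ) : ℂ) * vT n p := by
  have hK := congrFun (h.eigen n).apply_eq_smul p
  rw [Matrix.toLin'_apply, K_mulVec, Pi.smul_apply, smul_eq_mul] at hK
  push_cast
  linear_combination -hK

theorem toH_eigenFun_mem_span (m : Fin d) (w : Fin N × Fin d → ℂ) :
    toH η (eigenFun U m w) ∈ Submodule.span ℂ (Set.range fun n =>
      toH η (eigenFun U m (DBlockSqrt η ε x d *ᵥ vT n))) := by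
  let F : EuclideanSpace ℂ (Fin N × Fin d) →ₗ[ℂ] H N η :=
    toHLinear η ∘ₗ eigenFunLinear U m ∘ₗ (WithLp.linearEquiv 2 ℂ (Fin N × Fin d → ℂ)).toLinearMap
  -- `N * d` orthonormal vectors in a space of dimension `N * d` span it.
  have htop := h.orthonormal.linearIndependent.span_eq_top_of_card_eq_finrank' (by simp)
  have hw : WithLp.toLp 2 w ∈ Submodule.span ℂ (Set.range fun n =>
      (WithLp.toLp 2 (DBlockSqrt η ε x d *ᵥ vT n) : EuclideanSpace ℂ (Fin N × Fin d))) :=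
    htop ▸ Submodule.mem_top
  have hF := Submodule.mem_map_of_mem (f := F) hw
  rw [Submodule.map_span, ← Set.range_comp] at hF
  exact hF

variable [η.IsMulLeftInvariant]

theorem opP_apply (m : Fin d) (n : Fin (N * d)) :
    opP η ε x (toH η (eigenFun U m (vT n))) =
      ((1 - lamT n : ℝ) : ℂ) • toH η (eigenFun U m (vT n)) := by
  rw [opP, LinearMap.comp_apply, opW_eigenFun, diagOp_eigenFun, ← toH_eigenFun_smul]
  congr 2
  ext p
  rw [Complex.ofReal_inv, h.inv_D_mul_WHat_mulVec]
  rfl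

theorem opL_apply (m : Fin d) (n : Fin (N * d)) :
    opL η ε x (toH η (eigenFun U m (vT n))) = (lamT n : ℂ) • toH η (eigenFun U m (vT n)) := by
  change _ - opP η ε x _ = _
  rw [h.opP_apply, LinearMap.id_apply]
  push_cast
  rw [sub_smul, one_smul, sub_sub_cancel]

theorem opS_apply (m : Fin d) (n : Fin (N * d)) :
    opS η ε x (toH η (eigenFun U m (DBlockSqrt η ε x d *ᵥ vT n))) =
      ((1 - lamT n : ℝ) : ℂ) • toH η (eigenFun U m (DBlockSqrt η ε x d *ᵥ vT n)) := by
  have hD : ∀ i, (Real.sqrt (D η ε x i) : ℂ) ≠ 0 := fun i => by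
    exact_mod_cast (Real.sqrt_pos.mpr (D_pos ε x η i)).ne'
  have hDD : ∀ i, (D η ε x i : ℂ) = (Real.sqrt (D η ε x i) : ℂ) * Real.sqrt (D η ε x i) :=
    fun i => by exact_mod_cast (Real.mul_self_sqrt (D_pos ε x η i).le).symm
  rw [opS_eq, LinearMap.comp_apply, LinearMap.comp_apply, DBlockSqrt_mulVec, diagOp_eigenFun]
  -- The right factor `D^{-1/2}` undoes the `D^{1/2}` in `v`, so `W` acts on the function built from
  -- `vT`.
  simp_rw [Complex.ofReal_inv, inv_mul_cancel_left₀ (hD _)]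
  rw [opW_eigenFun, diagOp_eigenFun, ← toH_eigenFun_smul]
  congr 2
  ext p
  have hp := h.inv_D_mul_WHat_mulVec n p
  rw [hDD, mul_inv, mul_assoc] at hp
  rw [Complex.ofReal_inv, Pi.smul_apply, smul_eq_mul, mul_left_comm, ← hp,
    mul_inv_cancel_left₀ (hD _)]

end IsEigenSystem

/-- Different `l` are orthogonal by inequivalence; within one `l`, Schur orthogonality separates the
rows `m` and the orthonormal vectors `D^{1/2} vT` separate the `n`. -/
theorem orthonormal_toH_eigenFun [η.IsMulLeftInvariant] {I : Type*} {d : I → ℕ}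
    {U : ∀ l : I, G →ₜ* Matrix.unitaryGroup (Fin (d l)) ℂ} (hU : EnumeratesIURs U)
    {lamT : ∀ l, Fin (N * d l) → ℝ} {vT : ∀ l, Fin (N * d l) → Fin N × Fin (d l) → ℂ}
    (h : ∀ l, IsEigenSystem η ε x (U l) (lamT l) (vT l)) :
    Orthonormal ℂ (fun p : (l : I) × (Fin (d l) × Fin (N * d l)) =>
      toH η (eigenFun (U p.1) p.2.1 (DBlockSqrt η ε x (d p.1) *ᵥ vT p.1 p.2.2))) := by
  classical
  rw [orthonormal_iff_ite]
  rintro ⟨l, m, n⟩ ⟨l', m', n'⟩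
  by_cases hl : l = l'
  · subst hl
    have ho := orthonormal_iff_ite.mp (h l).orthonormal n n'
    rw [PiLp.inner_apply] at ho
    simp only [RCLike.inner_apply'] at ho
    rw [inner_eigenFun_self m η (hU.irreducible l), ho]
    by_cases hm : m = m' <;> by_cases hn : n = n' <;> simp [hm, hn]
  · rw [inner_eigenFun_eq_zero m η (hU.irreducible l) (hU.irreducible l')
      fun he => hl (hU.inequivalent l l' he), if_neg]
    intro heq
    exact hl (congrArg Sigma.fst heq)

end GInvariantGraph

/-! ### The spectral decomposition of `S`, `P` and the Laplacian. -/

theorem proposition3p1 {N q : ℕ} (G : Subgroup (Matrix.unitaryGroup (Fin q) ℂ)) [CompactSpace G]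
    [MeasurableSpace G] [BorelSpace G]
    (η : Measure G) [IsProbabilityMeasure η] [η.IsMulLeftInvariant]
    (ε : ℝ) (hε : 0 < ε) (x : Fin N → EuclideanSpace ℂ (Fin q))
    {I : Type*} {d : I → ℕ} (U : ∀ l : I, G →ₜ* Matrix.unitaryGroup (Fin (d l)) ℂ)
    (hU : EnumeratesIURs U) :
    -- the operator `S` equals `D^{-1/2} W D^{-1/2}` and is symmetric
    GInvariantGraph.opS η ε x =
        GInvariantGraph.diagOp η (fun i => (Real.sqrt (GInvariantGraph.D η ε x i))⁻¹) ∘ₗ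
          GInvariantGraph.opW η ε x ∘ₗ
          GInvariantGraph.diagOp η (fun i => (Real.sqrt (GInvariantGraph.D η ε x i))⁻¹) ∧
    (GInvariantGraph.opS η ε x).IsSymmetric ∧
    -- eigenvectors normalized as required exist
    (∀ l, ∃ lamT vT, GInvariantGraph.IsEigenSystem η ε x (U l) lamT vT) ∧
    -- and the following holds for every choice of them
    ∀ (lamT : ∀ l, Fin (N * d l) → ℝ) (vT : ∀ l, Fin (N * d l) → Fin N × Fin (d l) → ℂ)
      (v : ∀ l, Fin (N * d l) → Fin N × Fin (d l) → ℂ)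
      (lam : ∀ l, Fin (N * d l) → ℝ)
      (PhiT Phi : ∀ l, Fin (d l) → Fin (N * d l) → GInvariantGraph.H N η),
      (∀ l, GInvariantGraph.IsEigenSystem η ε x (U l) (lamT l) (vT l)) →
      (∀ l n, lam l n = 1 - lamT l n) →
      (∀ l n, v l n = GInvariantGraph.DBlockSqrt η ε x (d l) *ᵥ vT l n) →
      (∀ l m n, PhiT l m n =
        GInvariantGraph.toH η (GInvariantGraph.eigenFun (U l) m (vT l n))) →
      (∀ l m n, Phi l m n =
        GInvariantGraph.toH η (GInvariantGraph.eigenFun (U l) m (v l n))) →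
      (∀ l m n, Module.End.HasEigenvector (GInvariantGraph.opS η ε x)
        (lam l n : ℂ) (Phi l m n)) ∧
      Orthonormal ℂ (fun p : (l : I) × (Fin (d l) × Fin (N * d l)) =>
        Phi p.1 p.2.1 p.2.2) ∧
      (Submodule.span ℂ (Set.range fun p : (l : I) × (Fin (d l) × Fin (N * d l)) =>
        Phi p.1 p.2.1 p.2.2)).topologicalClosure = ⊤ ∧
      (∀ l m n, Module.End.HasEigenvector (GInvariantGraph.opP η ε x)
        (lam l n : ℂ) (PhiT l m n)) ∧
      (∀ l m n, Module.End.HasEigenvector (GInvariantGraph.opL η ε x)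
        (lamT l n : ℂ) (PhiT l m n)) ∧
      (∀ l m n, Phi l m n =
        GInvariantGraph.diagOp η (fun i => Real.sqrt (GInvariantGraph.D η ε x i))
          (PhiT l m n)) := by
  refine ⟨GInvariantGraph.opS_eq ε x η, GInvariantGraph.opS_isSymmetric ε x η,
    fun l => GInvariantGraph.exists_isEigenSystem ε x η (U l), ?_⟩
  intro lamT vT v lam PhiT Phi hsys hlam hv hPhiT hPhi
  obtain rfl : lam = fun l n => 1 - lamT l n := by
    ext l n
    exact hlam l n
  obtain rfl : v = fun l n => GInvariantGraph.DBlockSqrt η ε x (d l) *ᵥ vT l n := by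
    ext l n
    rw [hv]
  obtain rfl : PhiT = fun l m n =>
      GInvariantGraph.toH η (GInvariantGraph.eigenFun (U l) m (vT l n)) := by
    funext l m n
    exact hPhiT l m n
  obtain rfl : Phi = fun l m n => GInvariantGraph.toH η (GInvariantGraph.eigenFun (U l) m
      (GInvariantGraph.DBlockSqrt η ε x (d l) *ᵥ vT l n)) := by
    funext l m n
    exact hPhi l m n
  have horth := GInvariantGraph.orthonormal_toH_eigenFun hU hsys
  have hdiag : ∀ l m n, GInvariantGraph.toH η (GInvariantGraph.eigenFun (U l) m
      (GInvariantGraph.DBlockSqrt η ε x (d l) *ᵥ vT l n)) =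
      GInvariantGraph.diagOp η (fun i => Real.sqrt (GInvariantGraph.D η ε x i))
        (GInvariantGraph.toH η (GInvariantGraph.eigenFun (U l) m (vT l n))) := by
    intro l m n
    rw [GInvariantGraph.diagOp_eigenFun, GInvariantGraph.DBlockSqrt_mulVec]
  have hne : ∀ l m n, GInvariantGraph.toH η (GInvariantGraph.eigenFun (U l) m
      (GInvariantGraph.DBlockSqrt η ε x (d l) *ᵥ vT l n)) ≠ 0 :=
    fun l m n => horth.ne_zero ⟨l, m, n⟩
  -- `D^{1/2}` sends this function to a unit vector, so it cannot be zero.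
  have hneT : ∀ l m n, GInvariantGraph.toH η (GInvariantGraph.eigenFun (U l) m (vT l n)) ≠ 0 := by
    intro l m n h0
    apply hne l m n
    rw [hdiag, h0, map_zero]
  refine ⟨fun l m n => ?_, horth, ?_, fun l m n => ?_, fun l m n => ?_, hdiag⟩
  · exact Module.End.hasEigenvector_iff.mpr
      ⟨Module.End.mem_eigenspace_iff.mpr ((hsys l).opS_apply m n), hne l m n⟩
  -- The inclusion of `G` into `U(q)` is the faithful representation that Stone–Weierstrass needs.
  · let V : G →ₜ* Matrix.unitaryGroup (Fin q) ℂ := ⟨G.subtype, continuous_subtype_val⟩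
    refine GInvariantGraph.eq_top_of_toH_eigenFun_mem η hU V Subtype.val_injective _
      (Submodule.isClosed_topologicalClosure _) fun l m w => ?_
    refine Submodule.le_topologicalClosure _
      (Submodule.span_mono ?_ ((hsys l).toH_eigenFun_mem_span m w))
    rintro _ ⟨n, rfl⟩
    exact ⟨⟨l, m, n⟩, rfl⟩
  · exact Module.End.hasEigenvector_iff.mpr
      ⟨Module.End.mem_eigenspace_iff.mpr ((hsys l).opP_apply m n), hneT l m n⟩
  · exact Module.End.hasEigenvector_iff.mpr
      ⟨Module.End.mem_eigenspace_iff.mpr ((hsys l).opL_apply m n), hneT l m n⟩
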